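/- Let $\Lambda_{24}\subset\mathbb{R}^{24}$ be the Leech lattice, scaled so that its minimal vectors have length $2$; let $\mathcal{C}$ be the set of its $196560$ minimal vectors, and let $\mathrm{Co}_0$ be the group of distance-preserving bijections $\Lambda_{24}\to\Lambda_{24}$ that fix the origin. Call a set $A\subset\mathcal{C}$ admissible if it is antipodal ($x\in A$ implies $-x\in A$) and $\langle x,y\rangle\le 1$ for all distinct $x,y\in A$. For real $x$ let $\lfloor x\rfloor_2$ be the greatest even integer that is at most $x$. Let $S$ be admissible with $|S|\le 626$ and let $2\le k\le 50$. Let $S_1=S,S_2,\dots,S_k$ be mutually disjoint admissible sets such that each $S_j$ is contained in $g_jS$ for some $g_j\in\mathrm{Co}_0$ (for example $S_j=g_jS\setminus(S_1\cup\dots\cup S_{j-1})$ for $2\le j\le k$, with arbitrary $g_j\in\mathrm{Co}_0$). Put $$E_k=\frac{1}{|\mathrm{Co}_0|}\sum_{g\in \mathrm{Co}_0}\bigl|gS\cap(S_1\cup\dots\cup S_k)\bigr| .$$ If $\lfloor E_k\rfloor$ is even, then there are admissible sets $S_{k+1},S_{k+2}\subset\mathcal{C}$, each contained in $gS$ for some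 $g\in\mathrm{Co}_0$, such that $S_1,\dots,S_{k+2}$ are mutually disjoint and $$E_{k+2}=|S|\,\frac{\sum_{j=1}^{k}|S_j|+2\left(|S|-\lfloor E_k\rfloor_2\right)}{|\mathcal{C}|},$$ $$|S_{k+1}|+|S_{k+2}|\ge 2\left(|S|-\lfloor E_k\rfloor_2\right),\qquad 2|S_{k+1}|+|S_{k+2}|\ge 3\left(|S|-\lfloor E_k\rfloor_2\right),$$ where $E_{k+2}$ is defined as $E_k$ is, with $S_1,\dots,S_{k+2}$ in place of $S_1,\dots,S_k$. Moreover, these sets can be chosen so that either $|S_{k+1}|\ge|S|-\lfloor E_k\rfloor_2$ and $|S_{k+2}|\ge|S|-\lfloor E_k\rfloor_2$, or $|S_{k+1}|\ge|S|-\lfloor E_k\rfloor_2+2$ and $|S_{k+2}|\ge|S|-\lfloor E_k\rfloor_2-2$. -/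

import Mathlib

namespace Leech

noncomputable section

/-- The `a`-th generator of the extended quadratic residue code of length 24. The coordinates
`0, …, 22` are the residues modulo 23, the coordinate `23` is the point at infinity. The generator
is the indicator of `∞` together with all `i` such that `i + a` is a non-residue modulo 23. -/
def golayGen (a : ZMod 23) : Fin 24 → ZMod 2 := fun i =>
  if i = 23 ∨ ¬ IsSquare ((i.val : ZMod 23) + a) then 1 else 0

/-- The extended binary Golay code, as the extended quadratic residue code of length 24: it is
spanned by the 23 generators above and the all-one word. -/
def golayCode : Submodule (ZMod 2) (Fin 24 → ZMod 2) :=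
  Submodule.span (ZMod 2) (insert (fun _ => 1) (Set.range golayGen))

theorem one_mem_golayCode : (fun _ => 1 : Fin 24 → ZMod 2) ∈ golayCode :=
  Submodule.subset_span (Set.mem_insert _ _)

/-- The indicator word of the set of coordinates at which `x` is congruent to `k` modulo 4. -/
def residueWord (x : Fin 24 → ℤ) (k : ℤ) : Fin 24 → ZMod 2 := fun i =>
  if x i ≡ k [ZMOD 4] then 1 else 0

/-- The integral coordinates (that is, before division by `√8`) of the vectors of the Leech lattice:
all coordinates are congruent to some `m` modulo 2, their sum is congruent to `4 m` modulo 8, and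
for each `k` the coordinates congruent to `k` modulo 4 form a word of the Golay code. -/
def IsLeechInt (x : Fin 24 → ℤ) : Prop :=
  ∃ m : ℤ, (∀ i, x i ≡ m [ZMOD 2]) ∧ (∑ i, x i ≡ 4 * m [ZMOD 8]) ∧
    ∀ k : ℤ, residueWord x k ∈ golayCode

theorem IsLeechInt.zero : IsLeechInt 0 := by
  refine ⟨0, fun i => by simp [Int.ModEq], by simp [Int.ModEq], fun k => ?_⟩
  by_cases h : (0 : ℤ) ≡ k [ZMOD 4]
  · have : residueWord 0 k = fun _ => 1 := by funext i; simp [residueWord, h]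
    rw [this]; exact one_mem_golayCode
  · have : residueWord 0 k = 0 := by funext i; simp [residueWord, h]
    rw [this]; exact golayCode.zero_mem

theorem IsLeechInt.neg {x : Fin 24 → ℤ} (hx : IsLeechInt x) : IsLeechInt (-x) := by
  obtain ⟨m, h1, h2, h3⟩ := hx
  refine ⟨-m, fun i => by simpa using (h1 i).neg, ?_, fun k => ?_⟩
  · have := h2.neg
    simpa [Finset.sum_neg_distrib] using this
  · have : residueWord (-x) k = residueWord x (-k) := by
      funext i
      have : (-x) i ≡ k [ZMOD 4] ↔ x i ≡ -k [ZMOD 4] := by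
        simp only [Pi.neg_apply, Int.ModEq]; omega
      simp only [residueWord, this]
    rw [this]; exact h3 _

theorem IsLeechInt.add {x y : Fin 24 → ℤ} (hx : IsLeechInt x) (hy : IsLeechInt y) :
    IsLeechInt (x + y) := by
  obtain ⟨m, h1, h2, h3⟩ := hx
  obtain ⟨n, h1', h2', h3'⟩ := hy
  refine ⟨m + n, fun i => (h1 i).add (h1' i), ?_, fun k => ?_⟩
  · have := h2.add h2'
    simpa [Finset.sum_add_distrib, mul_add] using this
  · by_cases hk : k ≡ m + n [ZMOD 2]
    · have : residueWord (x + y) k =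
          (residueWord x m + residueWord y (k - m)) + fun _ => 1 := by
        funext i
        have e1 := h1 i
        have e2 := h1' i
        by_cases a : x i ≡ m [ZMOD 4] <;> by_cases b : y i ≡ k - m [ZMOD 4]
        all_goals
          have hp : ((x + y) i ≡ k [ZMOD 4]) ↔ ((x i ≡ m [ZMOD 4]) ↔ (y i ≡ k - m [ZMOD 4])) := by
            simp only [Pi.add_apply, Int.ModEq] at *; omega
          simp only [Pi.add_apply] at hp ⊢
          simp [residueWord, hp, a, b]
        all_goals decide
      rw [this]
      exact golayCode.add_mem (golayCode.add_mem (h3 _) (h3' _)) one_mem_golayCode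
    · have : residueWord (x + y) k = 0 := by
        funext i
        have e1 := h1 i
        have e2 := h1' i
        have hp : ¬ ((x + y) i ≡ k [ZMOD 4]) := by
          simp only [Pi.add_apply, Int.ModEq] at *; omega
        simp only [residueWord, if_neg hp, Pi.zero_apply]
      rw [this]; exact golayCode.zero_mem

/-- The Leech lattice in Euclidean 24-space, scaled so that its minimal vectors have length 2. -/
def leechLattice : AddSubgroup (EuclideanSpace ℝ (Fin 24)) where
  carrier := {v | ∃ x : Fin 24 → ℤ, IsLeechInt x ∧ ∀ i, v i = (x i : ℝ) / Real.sqrt 8}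
  zero_mem' := ⟨0, IsLeechInt.zero, fun i => by simp⟩
  add_mem' := by
    rintro v w ⟨x, hx, hv⟩ ⟨y, hy, hw⟩
    exact ⟨x + y, hx.add hy, fun i => by simp [hv i, hw i, add_div]⟩
  neg_mem' := by
    rintro v ⟨x, hx, hv⟩
    exact ⟨-x, hx.neg, fun i => by simp [hv i, neg_div]⟩

/-- The set `𝒞` of minimal vectors: the nonzero lattice vectors of least length. -/
def minimalVectors : Set leechLattice :=
  {x | x ≠ 0 ∧ ∀ y : leechLattice, y ≠ 0 → ‖x‖ ≤ ‖y‖}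

/-- The Conway group `Co₀`: the distance preserving bijections of the Leech lattice onto itself
which fix the origin. -/
def Co0 : Subgroup (leechLattice ≃ᵢ leechLattice) where
  carrier := {g | g 0 = 0}
  one_mem' := rfl
  mul_mem' := by
    intro a b ha hb
    change a (b 0) = 0
    rw [show b 0 = 0 from hb]; exact ha
  inv_mem' := by
    intro a ha
    exact (IsometryEquiv.symm_apply_eq a).2 (Eq.symm ha)

/-- The translate `g S`. -/
def translate (g : Co0) (S : Set leechLattice) : Set leechLattice :=
  (fun x => (g : leechLattice ≃ᵢ leechLattice) x) '' S

/-- Antipodal sets of minimal vectors any two distinct elements of which have inner product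
at most 1. -/
structure IsAdmissible (S : Set leechLattice) : Prop where
  minimal : S ⊆ minimalVectors
  antipodal : ∀ x ∈ S, -x ∈ S
  inner_le : ∀ x ∈ S, ∀ y ∈ S, x ≠ y →
    inner ℝ (x : EuclideanSpace ℝ (Fin 24)) (y : EuclideanSpace ℝ (Fin 24)) ≤ 1

/-- `T 1, …, T k` is a sequence of mutually disjoint admissible sets that starts with `S` and in
which each set is part of a translate of `S` under `Co₀`. (The values `T j` for `j = 0` and `j > k`
play no role.) Typical example: `T j = g_j S \ (T 1 ∪ ⋯ ∪ T (j - 1))` for `j ≥ 2`. -/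
structure IsDisjointSystem (S : Set leechLattice) (T : ℕ → Set leechLattice) (k : ℕ) : Prop where
  first : T 1 = S
  admissible : ∀ j ∈ Finset.Icc 1 k, IsAdmissible (T j)
  subset_translate : ∀ j ∈ Finset.Icc 1 k, ∃ g : Co0, T j ⊆ translate g S
  disjoint : ∀ i ∈ Finset.Icc 1 k, ∀ j ∈ Finset.Icc 1 k, i ≠ j → Disjoint (T i) (T j)

/-- `E_k`, the average of `|g S ∩ (T 1 ∪ ⋯ ∪ T k)|` over the (finite) group `Co₀`. -/
def expectedOverlap (S : Set leechLattice) (T : ℕ → Set leechLattice) (k : ℕ) : ℝ :=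
  (∑ᶠ g : Co0, ((translate g S ∩ ⋃ j ∈ Finset.Icc 1 k, T j).ncard : ℝ)) / (Nat.card Co0 : ℝ)

/-- `⌊x⌋₂`, the greatest even integer that is at most `x`. -/
def evenFloor (x : ℝ) : ℤ := 2 * ⌊x / 2⌋

theorem isGreatest_evenFloor (x : ℝ) : IsGreatest {n : ℤ | Even n ∧ (n : ℝ) ≤ x} (evenFloor x) := by
  refine ⟨⟨even_two_mul _, ?_⟩, ?_⟩
  · have := Int.floor_le (x / 2)
    simp only [evenFloor]; push_cast; linarith
  · rintro n ⟨⟨r, rfl⟩, h⟩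
    have : r ≤ ⌊x / 2⌋ := Int.le_floor.2 (by push_cast at h; linarith)
    simp only [evenFloor]; omega

end

end Leech

/-! The proof averages over `Co0` and exploits parity. Let U be the union of the sets already
chosen, n = |S|, and m = ⌊E_k⌋, which is even. `Co0` is transitive on the minimal vectors
(`exists_Co0_apply_eq`), so the average of |gS ∩ U| is n|U|/|𝒞| (`sum_ncard_translate_inter`), and
hence m ≤ n|U|/|𝒞| < m + 1. Antipodal sets of minimal vectors have even size, so all overlaps are
even.

Suppose that every overlap is at least m. Since the average is below m + 1 and any larger overlap is
at least m + 2, the overlap is exactly m for more than half of all g. Since 626² < 2|𝒞|, some h has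
hS ∩ S = ∅. A subset of `Co0` of more than half its size contains both g and gh for some g; then gS
and ghS are disjoint, and removing U leaves two sets of size n − m (`exists_disjoint_translates`).

Otherwise some overlap is at most m − 2, and gS \ U contains an antipodal A of size n − m + 2.
Adding A to U raises the average overlap by less than 2, so some g' meets U ∪ A in at most m + 2
points, and an antipodal B of size n − m − 2 remains (`exists_two_further_sets`). Either way |A| +
|B| = 2(n − m) exactly, which gives E_{k+2}.

The rest supplies transitivity, finiteness of `Co0`, and the bound |𝒞| ≥ 196008, all from the Golay
code. Transitivity uses sign changes on codewords, a cyclic shift of coordinates, and one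
reflection-type map attached to a sextet, which carry the three shapes of minimal vectors into each
other. -/

namespace Leech

/-! ### The Golay code by enumeration: size, weights and octads. -/

/-- The binary word of length 24 whose support is given by the binary digits of `n`. -/
def word (n : ℕ) : Fin 24 → ZMod 2 := fun i => if n.testBit i then 1 else 0

theorem word_xor (m n : ℕ) : word (m ^^^ n) = word m + word n := by
  funext i
  simp only [word, Nat.testBit_xor, Pi.add_apply]
  cases m.testBit i <;> cases n.testBit i <;> decide

/-- All sums, with respect to bitwise addition, of sublists of a list. -/
def xorSpan : List ℕ → List ℕ
  | [] => [0]
  | g :: l => xorSpan l ++ (xorSpan l).map (fun x => x ^^^ g)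

theorem zero_mem_xorSpan (l : List ℕ) : 0 ∈ xorSpan l := by
  induction l with
  | nil => simp [xorSpan]
  | cons g l ih => simp [xorSpan, ih]

theorem xor_mem_xorSpan {l : List ℕ} {m n : ℕ} (hm : m ∈ xorSpan l) (hn : n ∈ xorSpan l) :
    m ^^^ n ∈ xorSpan l := by
  induction l generalizing m n with
  | nil => simp_all [xorSpan]
  | cons g l ih =>
    simp only [xorSpan, List.mem_append, List.mem_map] at hm hn ⊢
    rcases hm with hm | ⟨m, hm, rfl⟩ <;> rcases hn with hn | ⟨n, hn, rfl⟩
    · exact Or.inl (ih hm hn)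
    · exact Or.inr ⟨_, ih hm hn, by rw [Nat.xor_assoc]⟩
    · exact Or.inr ⟨_, ih hm hn, by rw [Nat.xor_assoc, Nat.xor_assoc, Nat.xor_comm n g]⟩
    · refine Or.inl ?_
      have : m ^^^ g ^^^ (n ^^^ g) = m ^^^ n := by
        rw [Nat.xor_comm n g, Nat.xor_assoc, ← Nat.xor_assoc g, Nat.xor_self, Nat.zero_xor]
      rw [this]; exact ih hm hn

theorem word_mem_of_mem_xorSpan {l : List ℕ} {C : Submodule (ZMod 2) (Fin 24 → ZMod 2)}
    (h : ∀ g ∈ l, word g ∈ C) {n : ℕ} (hn : n ∈ xorSpan l) : word n ∈ C := by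
  induction l generalizing n with
  | nil =>
    obtain rfl : n = 0 := by simpa [xorSpan] using hn
    have : word 0 = 0 := by funext i; simp [word]
    rw [this]; exact C.zero_mem
  | cons g l ih =>
    simp only [xorSpan, List.mem_append, List.mem_map] at hn
    rcases hn with hn | ⟨n, hn, rfl⟩
    · exact ih (fun g hg => h g (by simp [hg])) hn
    · rw [word_xor]
      exact C.add_mem (ih (fun g hg => h g (by simp [hg])) hn) (h g (by simp))

/-- The words with support encoded in `xorSpan l` form a subspace. -/
def wordSpan (l : List ℕ) : Submodule (ZMod 2) (Fin 24 → ZMod 2) where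
  carrier := {w | ∃ n ∈ xorSpan l, word n = w}
  zero_mem' := ⟨0, zero_mem_xorSpan l, by funext i; simp [word]⟩
  add_mem' := by
    rintro _ _ ⟨m, hm, rfl⟩ ⟨n, hn, rfl⟩
    exact ⟨m ^^^ n, xor_mem_xorSpan hm hn, word_xor m n⟩
  smul_mem' := by
    rintro c _ ⟨m, hm, rfl⟩
    have hc : c = 0 ∨ c = 1 := by revert c; decide
    rcases hc with rfl | rfl
    · exact ⟨0, zero_mem_xorSpan l, by funext i; simp [word]⟩
    · exact ⟨m, hm, by simp⟩

/-- Encodings of the generators of the Golay code. -/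
def golayGenNat (a : ℕ) : ℕ :=
  2 ^ 23 + ((List.range 23).map fun i =>
    if (i + a) % 23 ∈ [0, 1, 2, 3, 4, 6, 8, 9, 12, 13, 16, 18] then 0 else 2 ^ i).sum

theorem golayGen_eq_word (a : ZMod 23) : golayGen a = word (golayGenNat a.val) := by
  funext i
  revert a i
  unfold golayGen
  decide +kernel

theorem one_eq_word : (fun _ => 1 : Fin 24 → ZMod 2) = word (2 ^ 24 - 1) := by
  decide +kernel

/-- A basis of the Golay code in echelon form. -/
def golayBasis : List ℕ :=
  [14919680, 11654144, 8077824, 4038912, 2019456, 15515712, 11952160, 10170384, 7221256,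
    13938692, 4845570, 13062145]

/-- The encodings of the words of the Golay code. -/
def golayNat : List ℕ := xorSpan golayBasis

theorem golayBasis_mem : ∀ g ∈ golayBasis,
    g ∈ xorSpan ((2 ^ 24 - 1) :: (List.range 11).map golayGenNat) := by
  decide +kernel

theorem golayGenNat_mem : ∀ a < 23, golayGenNat a ∈ golayNat := by
  decide +kernel

theorem allOnes_mem : 2 ^ 24 - 1 ∈ golayNat := by
  decide +kernel

theorem mem_golayCode_iff {w : Fin 24 → ZMod 2} :
    w ∈ golayCode ↔ ∃ n ∈ golayNat, word n = w := by
  constructor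
  · intro hw
    have : golayCode ≤ wordSpan golayBasis := by
      refine Submodule.span_le.2 ?_
      rintro w (rfl | ⟨a, rfl⟩)
      · exact ⟨_, allOnes_mem, one_eq_word.symm⟩
      · exact ⟨_, golayGenNat_mem _ a.val_lt, (golayGen_eq_word a).symm⟩
    exact this hw
  · rintro ⟨n, hn, rfl⟩
    refine word_mem_of_mem_xorSpan (fun g hg => ?_) hn
    refine word_mem_of_mem_xorSpan (fun g hg => ?_) (golayBasis_mem g hg)
    rcases List.mem_cons.1 hg with rfl | hg
    · rw [← one_eq_word]; exact one_mem_golayCode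
    · obtain ⟨a, ha, rfl⟩ := List.mem_map.1 hg
      have h11 := List.mem_range.1 ha
      have : golayGenNat a = golayGenNat ((a : ZMod 23)).val := by
        rw [ZMod.val_natCast, Nat.mod_eq_of_lt (by omega)]
      rw [this, ← golayGen_eq_word]
      exact Submodule.subset_span (Set.mem_insert_of_mem _ ⟨_, rfl⟩)

/-- The number of ones among the last `k` binary digits. -/
def popCount : ℕ → ℕ → ℕ
  | 0, _ => 0
  | k + 1, n => n % 2 + popCount k (n / 2)

theorem popCount_eq (k n : ℕ) :
    popCount k n = ∑ i ∈ Finset.range k, (n.testBit i).toNat := by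
  induction k generalizing n with
  | zero => simp [popCount]
  | succ k ih =>
    rw [popCount, ih, Finset.sum_range_succ', add_comm]
    congr 1
    · refine Finset.sum_congr rfl fun i _ => by rw [Nat.testBit_succ]
    · rw [Nat.testBit_zero]
      rcases Nat.mod_two_eq_zero_or_one n with h | h <;> simp [h]

/-- The number of nonzero coordinates of a binary word. -/
def weight (w : Fin 24 → ZMod 2) : ℕ := (Finset.univ.filter fun i => w i = 1).card

theorem weight_word (n : ℕ) : weight (word n) = popCount 24 n := by
  rw [popCount_eq, Finset.sum_range, weight, Finset.card_filter]
  refine Finset.sum_congr rfl fun i _ => ?_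
  rw [word]
  rcases h : n.testBit i <;> simp

/-- The code is doubly even with no word of weight 4, so its minimum weight is 8. -/
theorem golayNat_weight : ∀ n ∈ golayNat, popCount 24 n % 4 = 0 ∧ popCount 24 n ≠ 4 := by
  have : golayNat.all (fun n => popCount 24 n % 4 == 0 && popCount 24 n != 4) = true := by
    decide +kernel
  simpa [List.all_eq_true] using this

theorem four_dvd_weight {w : Fin 24 → ZMod 2} (hw : w ∈ golayCode) : 4 ∣ weight w := by
  obtain ⟨n, hn, rfl⟩ := mem_golayCode_iff.1 hw
  rw [weight_word]; exact Nat.dvd_of_mod_eq_zero (golayNat_weight n hn).1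

theorem eight_le_weight {w : Fin 24 → ZMod 2} (hw : w ∈ golayCode) (h0 : w ≠ 0) :
    8 ≤ weight w := by
  have h4 := four_dvd_weight hw
  have hne : weight w ≠ 4 := by
    obtain ⟨n, hn, rfl⟩ := mem_golayCode_iff.1 hw
    rw [weight_word]; exact (golayNat_weight n hn).2
  have hpos : weight w ≠ 0 := by
    intro h
    apply h0
    funext i
    have : i ∉ Finset.univ.filter fun i => w i = 1 := by
      rw [Finset.card_eq_zero.1 h]; simp
    have h1 : w i ≠ 1 := by simpa using this
    have : ∀ z : ZMod 2, z ≠ 1 → z = 0 := by decide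
    exact this _ h1
  omega

/-- The echelon basis makes the last twelve binary digits an information set: the enumeration runs
through their values in increasing order, so its 4096 words are distinct. -/
theorem golayNat_mod : golayNat.map (· % 4096) = List.range 4096 := by
  have : (golayNat.map (· % 4096) == List.range 4096) = true := by decide +kernel
  exact beq_iff_eq.1 this

theorem golayNat_nodup : golayNat.Nodup :=
  List.Nodup.of_map (· % 4096) (by rw [golayNat_mod]; exact List.nodup_range)

theorem golayNat_length : golayNat.length = 4096 := by
  have := congrArg List.length golayNat_mod
  simpa using this

theorem golayNat_octads : (golayNat.filter fun n => popCount 24 n = 8).length = 759 := by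
  rw [← List.countP_eq_length_filter]
  decide +kernel

theorem golayNat_lt : ∀ n ∈ golayNat, n < 2 ^ 24 := by
  have : golayNat.all (fun n => decide (n < 2 ^ 24)) = true := by decide +kernel
  simpa [List.all_eq_true] using this

theorem word_injOn {m n : ℕ} (hm : m < 2 ^ 24) (hn : n < 2 ^ 24) (h : word m = word n) :
    m = n := by
  refine Nat.eq_of_testBit_eq fun i => ?_
  by_cases hi : i < 24
  · have := congrFun h ⟨i, hi⟩
    simp only [word] at this
    revert this
    cases m.testBit i <;> cases n.testBit i <;> simp
  · rw [Nat.testBit_lt_two_pow (hm.trans_le (Nat.pow_le_pow_right (by norm_num) (by omega))),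
      Nat.testBit_lt_two_pow (hn.trans_le (Nat.pow_le_pow_right (by norm_num) (by omega)))]

/-- The words of the Golay code as a finite set. -/
def golayFinset : Finset (Fin 24 → ZMod 2) := (golayNat.map word).toFinset

theorem mem_golayFinset {w : Fin 24 → ZMod 2} : w ∈ golayFinset ↔ w ∈ golayCode := by
  simp [golayFinset, mem_golayCode_iff]

theorem card_golayFinset : golayFinset.card = 4096 := by
  rw [golayFinset, List.toFinset_card_of_nodup, List.length_map, golayNat_length]
  exact List.Nodup.map_on
    (fun m hm n hn h => word_injOn (golayNat_lt m hm) (golayNat_lt n hn) h) golayNat_nodup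

theorem card_octads : (golayFinset.filter fun w => weight w = 8).card = 759 := by
  have : (golayFinset.filter fun w => weight w = 8) =
      ((golayNat.filter fun n => popCount 24 n = 8).map word).toFinset := by
    ext w
    simp only [golayFinset, Finset.mem_filter, List.mem_toFinset, List.mem_map, List.mem_filter,
      decide_eq_true_eq]
    constructor
    · rintro ⟨⟨n, hn, rfl⟩, h⟩
      exact ⟨n, ⟨hn, by rw [← weight_word, h]⟩, rfl⟩
    · rintro ⟨n, ⟨hn, h⟩, rfl⟩
      exact ⟨⟨n, hn, rfl⟩, by rw [weight_word, h]⟩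
  rw [this, List.toFinset_card_of_nodup, List.length_map, golayNat_octads]
  refine List.Nodup.map_on (fun m hm n hn h => ?_) (golayNat_nodup.filter _)
  exact word_injOn (golayNat_lt m (List.mem_filter.1 hm).1) (golayNat_lt n (List.mem_filter.1 hn).1) h

attribute [irreducible] golayNat golayFinset

/-! ### The cyclic symmetry and a sextet of the Golay code. -/

/-- The cyclic shift of the coordinates `0, …, 22`. -/
def cyc : Equiv.Perm (Fin 24) where
  toFun i := if h : i.val < 23 then ⟨(i.val + 1) % 23, by omega⟩ else i
  invFun i := if h : i.val < 23 then ⟨(i.val + 22) % 23, by omega⟩ else i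
  left_inv := by decide +kernel
  right_inv := by decide +kernel

theorem golayGen_comp_cyc (a : ZMod 23) : golayGen a ∘ cyc = golayGen (a + 1) := by
  have : ∀ (a : ZMod 23) (i : Fin 24), golayGen a (cyc i) = golayGen (a + 1) i := by
    unfold golayGen
    decide +kernel
  exact funext fun i => this a i

theorem comp_cyc_mem {w : Fin 24 → ZMod 2} (hw : w ∈ golayCode) : w ∘ cyc ∈ golayCode := by
  induction hw using Submodule.span_induction with
  | mem w h =>
    rcases h with rfl | ⟨a, rfl⟩
    · exact one_mem_golayCode
    · rw [golayGen_comp_cyc]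
      exact Submodule.subset_span (Set.mem_insert_of_mem _ ⟨_, rfl⟩)
  | zero => exact golayCode.zero_mem
  | add v w _ _ hv hw => exact golayCode.add_mem hv hw
  | smul c w _ hw => exact golayCode.smul_mem c hw

/-- The six tetrads of a sextet. -/
def tetrad (b : Fin 6) : Fin 4 → Fin 24 :=
  match b with
  | 0 => ![0, 1, 2, 23]
  | 1 => ![4, 13, 16, 22]
  | 2 => ![3, 5, 14, 17]
  | 3 => ![6, 7, 19, 21]
  | 4 => ![9, 10, 15, 20]
  | 5 => ![8, 11, 12, 18]

/-- The index of the tetrad to which a coordinate belongs. -/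
def sextet : Fin 24 → Fin 6 :=
  ![0, 0, 0, 2, 1, 2, 3, 3, 5, 4, 4, 5, 5, 1, 2, 4, 1, 2, 5, 3, 4, 3, 1, 0]

theorem filter_sextet (b : Fin 6) :
    (Finset.univ.filter fun i => sextet i = b) = Finset.univ.image (tetrad b) := by
  revert b; decide +kernel

theorem tetrad_injective (b : Fin 6) : Function.Injective (tetrad b) := by
  revert b; unfold Function.Injective; decide +kernel

theorem sum_sextet {M : Type*} [AddCommMonoid M] (f : Fin 24 → M) (b : Fin 6) :
    (∑ i, if sextet i = b then f i else 0) = ∑ r, f (tetrad b r) := by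
  rw [← Finset.sum_filter, filter_sextet, Finset.sum_image]
  exact fun _ _ _ _ h => tetrad_injective b h

theorem sum_eq_sum_tetrad {M : Type*} [AddCommMonoid M] (f : Fin 24 → M) :
    ∑ i, f i = ∑ b, ∑ r, f (tetrad b r) := by
  simp_rw [← sum_sextet]
  rw [Finset.sum_comm]
  refine Finset.sum_congr rfl fun i _ => by simp

theorem sextet_tetrad (b : Fin 6) (r : Fin 4) : sextet (tetrad b r) = b := by
  revert b r; decide +kernel

/-- The defining property of a sextet: any two of its tetrads together form an octad. The first
tetrad serves as the reference, so for `b = 0` the word is zero. -/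
theorem tetrad_add_tetrad_mem (b : Fin 6) :
    (fun i => (if sextet i = b then 1 else 0) + (if sextet i = 0 then 1 else 0) :
      Fin 24 → ZMod 2) ∈ golayCode := by
  have key : ∀ b : Fin 6,
      (((List.finRange 24).map fun i =>
        if (sextet i = b) ↔ (sextet i = 0) then 0 else 2 ^ i.val).sum ∈ golayNat) ∧
      ∀ i, word ((List.finRange 24).map fun i =>
        if (sextet i = b) ↔ (sextet i = 0) then 0 else 2 ^ i.val).sum i =
        (if sextet i = b then 1 else 0) + (if sextet i = 0 then 1 else 0) := by
    decide +kernel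
  exact mem_golayCode_iff.2 ⟨_, (key b).1, funext (key b).2⟩

theorem comp_sextet_mem {f : Fin 6 → ZMod 2} (hf : ∑ b, f b = 0) :
    (fun i => f (sextet i)) ∈ golayCode := by
  have : (fun i => f (sextet i)) = ∑ b, f b •
      (fun i => (if sextet i = b then 1 else 0) + (if sextet i = 0 then 1 else 0) :
        Fin 24 → ZMod 2) := by
    funext i
    simp only [Finset.sum_apply, Pi.smul_apply, smul_eq_mul, mul_add, Finset.sum_add_distrib,
      mul_ite, mul_one, mul_zero, Finset.sum_ite_eq, Finset.mem_univ, if_true]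
    split_ifs <;> simp [hf]
  rw [this]
  exact golayCode.sum_mem fun b _ => golayCode.smul_mem _ (tetrad_add_tetrad_mem b)

/-- A list of exponents such that each octad is met oddly by all tetrads of one of the
corresponding shifts of the sextet. -/
def shifts : List ℕ := [0, 21, 19, 10, 15, 13, 17, 16]

theorem cyc_pow_apply : ∀ a ∈ shifts, ∀ i : Fin 24,
    ((cyc ^ a) i).val = if i.val = 23 then 23 else (i.val + a) % 23 := by
  decide +kernel

theorem octads_odd : golayNat.all (fun n => popCount 24 n != 8 || shifts.any fun a =>
    (List.finRange 6).all fun b => ((List.finRange 4).map fun r =>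
      (n.testBit (if (tetrad b r).val = 23 then 23
        else ((tetrad b r).val + a) % 23)).toNat).sum % 2 == 1) = true := by
  decide +kernel

/-- For a vector with entries ±2 on an octad, an odd intersection with a tetrad makes half the
tetrad sum odd. `sextetMap` then turns the vector into one with odd coordinates. -/
theorem exists_shift_odd {w : Fin 24 → ZMod 2} (hw : w ∈ golayCode) (h8 : weight w = 8) :
    ∃ a : ℕ, ∀ b, ∑ r, w ((cyc ^ a) (tetrad b r)) = 1 := by
  obtain ⟨n, hn, rfl⟩ := mem_golayCode_iff.1 hw
  have h := List.all_eq_true.1 octads_odd n hn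
  rw [weight_word] at h8
  simp only [h8, bne_self_eq_false, Bool.false_or, List.any_eq_true, List.all_eq_true] at h
  obtain ⟨a, ha, h⟩ := h
  refine ⟨a, fun b => ?_⟩
  have hb := h b (List.mem_finRange b)
  rw [beq_iff_eq, ← Fin.sum_univ_def] at hb
  have hw : ∀ i, word n i = ((n.testBit i.val).toNat : ZMod 2) := by
    intro i
    rw [word]
    cases n.testBit i.val <;> simp
  simp only [hw, cyc_pow_apply a ha]
  rw [← Nat.cast_sum]
  have := (ZMod.natCast_eq_natCast_iff' _ 1 2).2 hb
  simpa using this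

/-! ### Congruence description of the lattice and three kinds of automorphisms. -/

theorem weight_eq_sum (w : Fin 24 → ZMod 2) : weight w = ∑ i, (w i).val := by
  rw [weight, Finset.card_filter]
  refine Finset.sum_congr rfl fun i _ => ?_
  generalize w i = z
  revert z; decide

theorem val_add_intCast (a : ZMod 2) (z : ℤ) :
    ((a + (z : ZMod 2)).val : ℤ) ≡ a.val + z [ZMOD 2] := by
  refine (ZMod.intCast_eq_intCast_iff _ _ 2).1 ?_
  push_cast
  simp

/-- A single codeword determines all the residue words: since all coordinates have the parity of m,
only the classes m and m + 2 modulo 4 occur, on complementary sets, and the all-one word lies in the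
code. -/
theorem isLeechInt_iff {x : Fin 24 → ℤ} : IsLeechInt x ↔ ∃ m : ℤ, ∃ c ∈ golayCode,
    (∀ i, x i ≡ m + 2 * (c i).val [ZMOD 4]) ∧ ∑ i, x i ≡ 4 * m [ZMOD 8] := by
  constructor
  · rintro ⟨m, h1, h2, h3⟩
    refine ⟨m, residueWord x (m + 2), h3 _, fun i => ?_, h2⟩
    have := h1 i
    by_cases h : x i ≡ m + 2 [ZMOD 4]
    · have : (1 : ZMod 2).val = 1 := rfl
      simpa only [residueWord, if_pos h, this, Nat.cast_one, mul_one] using h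
    · simp only [residueWord, if_neg h, ZMod.val_zero, Nat.cast_zero, mul_zero, add_zero]
      simp only [Int.ModEq] at *
      omega
  · rintro ⟨m, c, hc, h1, h2⟩
    have hv : ∀ i, (c i = 0 ∧ (c i).val = 0) ∨ (c i = 1 ∧ (c i).val = 1) := by
      intro i
      generalize c i = z
      revert z; decide
    refine ⟨m, fun i => ?_, h2, fun k => ?_⟩
    · have := h1 i
      simp only [Int.ModEq] at *
      omega
    · by_cases k0 : k ≡ m [ZMOD 4]
      · have : residueWord x k = c + fun _ => 1 := by
          funext i
          have e := h1 i
          rcases hv i with ⟨h, h'⟩ | ⟨h, h'⟩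
          · have : x i ≡ k [ZMOD 4] := by rw [h'] at e; simp only [Int.ModEq] at *; omega
            simp [residueWord, this, h]
          · have : ¬ x i ≡ k [ZMOD 4] := by rw [h'] at e; simp only [Int.ModEq] at *; omega
            simp only [residueWord, this, h, Pi.add_apply, if_false]; decide
        rw [this]
        exact golayCode.add_mem hc one_mem_golayCode
      by_cases k2 : k ≡ m + 2 [ZMOD 4]
      · have : residueWord x k = c := by
          funext i
          have e := h1 i
          rcases hv i with ⟨h, h'⟩ | ⟨h, h'⟩
          · have : ¬ x i ≡ k [ZMOD 4] := by rw [h'] at e; simp only [Int.ModEq] at *; omega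
            simp [residueWord, this, h]
          · have : x i ≡ k [ZMOD 4] := by rw [h'] at e; simp only [Int.ModEq] at *; omega
            simp [residueWord, this, h]
        rw [this]
        exact hc
      · have : residueWord x k = 0 := by
          funext i
          have e := h1 i
          have : ¬ x i ≡ k [ZMOD 4] := by
            rcases hv i with ⟨_, h'⟩ | ⟨_, h'⟩ <;> rw [h'] at e <;>
              simp only [Int.ModEq] at * <;> omega
          simp [residueWord, this]
        rw [this]
        exact golayCode.zero_mem

/-- Lattice vectors have even pairing with the octad vectors. -/
theorem IsLeechInt.sum_codeword {x : Fin 24 → ℤ} (hx : IsLeechInt x) {w : Fin 24 → ZMod 2}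
    (hw : w ∈ golayCode) : (4 : ℤ) ∣ ∑ i, (w i).val * x i := by
  obtain ⟨m, c, hc, h1, -⟩ := isLeechInt_iff.1 hx
  have e1 : ∑ i, ((w i).val : ℤ) * x i ≡ ∑ i, ((w i).val : ℤ) * (m + 2 * (c i).val) [ZMOD 4] :=
    Int.ModEq.sum fun i _ => (h1 i).mul_left _
  -- Here 2|w ∩ c| = |w| + |c| − |w + c|, and all three weights are divisible by 4.
  have e2 : ∑ i, ((w i).val : ℤ) * (m + 2 * (c i).val) =
      m * weight w + (weight w + weight c - weight (w + c)) := by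
    simp only [weight_eq_sum, Nat.cast_sum, Finset.mul_sum]
    rw [← Finset.sum_add_distrib, ← Finset.sum_sub_distrib, ← Finset.sum_add_distrib]
    refine Finset.sum_congr rfl fun i _ => ?_
    have : ∀ a b : ZMod 2, ((a + b).val : ℤ) = a.val + b.val - 2 * (a.val * b.val) := by decide
    rw [Pi.add_apply, this]; ring
  have w1 : (4 : ℤ) ∣ weight w := by exact_mod_cast four_dvd_weight hw
  have w2 : (4 : ℤ) ∣ weight c := by exact_mod_cast four_dvd_weight hc
  have w3 : (4 : ℤ) ∣ weight (w + c) := by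
    exact_mod_cast four_dvd_weight (golayCode.add_mem hw hc)
  refine (Int.ModEq.dvd_iff e1).2 ?_
  rw [e2]
  exact dvd_add (w1.mul_left _) (dvd_sub (dvd_add w1 w2) w3)

/-- The change of signs on the support of a binary word. -/
def signChange (w : Fin 24 → ZMod 2) (x : Fin 24 → ℤ) : Fin 24 → ℤ :=
  fun i => if w i = 1 then -x i else x i

theorem signChange_signChange (w : Fin 24 → ZMod 2) (x : Fin 24 → ℤ) :
    signChange w (signChange w x) = x := by
  funext i; simp only [signChange]; split_ifs <;> simp

theorem signChange_sub (w : Fin 24 → ZMod 2) (x y : Fin 24 → ℤ) :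
    signChange w (x - y) = signChange w x - signChange w y := by
  funext i; simp only [signChange, Pi.sub_apply]; split_ifs <;> ring

theorem sum_sq_signChange (w : Fin 24 → ZMod 2) (x : Fin 24 → ℤ) :
    ∑ i, signChange w x i ^ 2 = ∑ i, x i ^ 2 := by
  refine Finset.sum_congr rfl fun i _ => ?_
  simp only [signChange]; split_ifs <;> ring

theorem IsLeechInt.signChange {x : Fin 24 → ℤ} (hx : IsLeechInt x) {w : Fin 24 → ZMod 2}
    (hw : w ∈ golayCode) : IsLeechInt (signChange w x) := by
  obtain ⟨m, c, hc, h1, h2⟩ := isLeechInt_iff.1 hx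
  -- Negation changes an odd coordinate by 2 modulo 4 and leaves an even one fixed, so the codeword
  -- changes by w exactly when m is odd.
  refine isLeechInt_iff.2 ⟨m, c + (m : ZMod 2) • w,
    golayCode.add_mem hc (golayCode.smul_mem _ hw), fun i => ?_, ?_⟩
  · have e := h1 i
    simp only [Leech.signChange, Pi.add_apply, Pi.smul_apply, smul_eq_mul]
    have hz : w i = 0 ∨ w i = 1 := by generalize w i = z; revert z; decide
    rcases hz with h | h
    · simpa [h] using e
    · have e' := val_add_intCast (c i) m
      simp only [h, if_true, mul_one]
      simp only [Int.ModEq] at *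
      omega
  · have hs : ∑ i, Leech.signChange w x i = ∑ i, x i - 2 * ∑ i, (w i).val * x i := by
      rw [Finset.mul_sum, ← Finset.sum_sub_distrib]
      refine Finset.sum_congr rfl fun i _ => ?_
      simp only [Leech.signChange]
      have hz : w i = 0 ∨ w i = 1 := by generalize w i = z; revert z; decide
      rcases hz with h | h
      · simp [h]
      · have : (1 : ZMod 2).val = 1 := rfl
        simp only [h, if_true, this]; push_cast; ring
    have := hx.sum_codeword hw
    rw [hs]
    simp only [Int.ModEq] at *
    omega

theorem IsLeechInt.comp_cyc {x : Fin 24 → ℤ} (hx : IsLeechInt x) : IsLeechInt (x ∘ cyc) := by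
  obtain ⟨m, c, hc, h1, h2⟩ := isLeechInt_iff.1 hx
  refine isLeechInt_iff.2 ⟨m, c ∘ cyc, comp_cyc_mem hc, fun i => h1 _, ?_⟩
  rw [← Equiv.sum_comp cyc] at h2
  exact h2

theorem IsLeechInt.comp_cyc_pow {x : Fin 24 → ℤ} (hx : IsLeechInt x) (a : ℕ) :
    IsLeechInt (x ∘ (cyc ^ a : Equiv.Perm (Fin 24))) := by
  induction a with
  | zero => simpa using hx
  | succ a ih => rw [pow_succ]; exact ih.comp_cyc

theorem cyc_pow_23 : cyc ^ 23 = 1 := by decide +kernel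

/-- The sum of the coordinates in a tetrad. -/
def tetradSum (x : Fin 24 → ℤ) (b : Fin 6) : ℤ := ∑ r, x (tetrad b r)

/-- The half-sums of the six tetrads share one parity, because the union of two tetrads is a
codeword and `IsLeechInt.sum_codeword` applies. This makes all coordinates of `sextetMap x`
congruent modulo 2. -/
theorem IsLeechInt.tetradSum_eq {x : Fin 24 → ℤ} (hx : IsLeechInt x) :
    ∃ h : Fin 6 → ℤ, (∀ b, tetradSum x b = 2 * h b) ∧ ∃ q : Fin 6 → ℤ, ∀ b, h b + h 0 = 2 * q b := by
  obtain ⟨m, h1, -, -⟩ := id hx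
  have even : ∀ b, (2 : ℤ) ∣ tetradSum x b := by
    intro b
    have := h1 (tetrad b 0); have := h1 (tetrad b 1)
    have := h1 (tetrad b 2); have := h1 (tetrad b 3)
    simp only [tetradSum, Fin.sum_univ_four, Int.ModEq] at *
    omega
  choose h hh using even
  refine ⟨h, hh, ?_⟩
  have : ∀ b, (2 : ℤ) ∣ h b + h 0 := by
    intro b
    by_cases hb : b = 0
    · subst hb; exact ⟨h 0, by ring⟩
    have h4 := hx.sum_codeword (tetrad_add_tetrad_mem b)
    have e : ∑ i, ((((if sextet i = b then 1 else 0) + (if sextet i = 0 then 1 else 0) :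
        ZMod 2).val : ℕ) : ℤ) * x i = tetradSum x b + tetradSum x 0 := by
      rw [tetradSum, tetradSum, ← sum_sextet, ← sum_sextet, ← Finset.sum_add_distrib]
      refine Finset.sum_congr rfl fun i _ => ?_
      have h1 : (1 : ZMod 2).val = 1 := rfl
      by_cases hi : sextet i = b
      · have : sextet i ≠ 0 := by rw [hi]; exact hb
        simp [hi, hb, h1]
      · by_cases hj : sextet i = 0
        · simp [hj, Ne.symm hb, h1]
        · simp [hi, hj]
    rw [e, hh, hh] at h4
    omega
  choose q hq using this
  exact ⟨q, hq⟩

/-- The automorphism of the lattice attached to a sextet: on each tetrad, half the sum of the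
coordinates is subtracted; then the signs are changed on the first tetrad. -/
def sextetMap (x : Fin 24 → ℤ) : Fin 24 → ℤ := fun i =>
  if sextet i = 0 then -(x i - tetradSum x (sextet i) / 2) else x i - tetradSum x (sextet i) / 2

theorem sextetMap_apply {x : Fin 24 → ℤ} {h : Fin 6 → ℤ} (hh : ∀ b, tetradSum x b = 2 * h b)
    (i : Fin 24) :
    sextetMap x i = if sextet i = 0 then -(x i - h (sextet i)) else x i - h (sextet i) := by
  simp [sextetMap, hh]

theorem IsLeechInt.sextetMap {x : Fin 24 → ℤ} (hx : IsLeechInt x) : IsLeechInt (sextetMap x) := by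
  obtain ⟨h, hh, q, hq⟩ := hx.tetradSum_eq
  obtain ⟨m, c, hc, h1, h2⟩ := isLeechInt_iff.1 hx
  rw [sum_eq_sum_tetrad] at h2
  change ∑ b, tetradSum x b ≡ _ [ZMOD 8] at h2
  simp only [hh, Fin.sum_univ_six] at h2
  have q0 := hq 0; have q1 := hq 1; have q2 := hq 2
  have q3 := hq 3; have q4 := hq 4; have q5 := hq 5
  -- The new residue is m + h 0. Off the first tetrad −h b = h 0 − 2 q b contributes q b to the
  -- codeword; on it the sign change contributes m, which agrees with q 0 + m + h 0 modulo 2 because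
  -- q 0 = h 0.
  let f : Fin 6 → ℤ := fun b => q b + if b = 0 then m + h 0 else 0
  have hf : ∑ b, (f b : ZMod 2) = 0 := by
    rw [← Int.cast_sum]
    refine (ZMod.intCast_zmod_eq_zero_iff_dvd _ 2).2 ?_
    simp only [f, Fin.sum_univ_six]
    simp only [Int.ModEq] at h2
    simp
    omega
  refine isLeechInt_iff.2 ⟨m + h 0, c + fun i => (f (sextet i) : ZMod 2),
    golayCode.add_mem hc (comp_sextet_mem hf), fun i => ?_, ?_⟩
  · rw [sextetMap_apply hh]
    have e := h1 i
    have e' := val_add_intCast (c i) (f (sextet i))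
    have e2 := hq (sextet i)
    simp only [Pi.add_apply]
    generalize (c i + (f (sextet i) : ZMod 2)).val = v at *
    simp only [f] at e'
    split_ifs at * with hi
    · simp only [hi] at *
      simp only [Int.ModEq] at *
      omega
    · simp only [Int.ModEq] at *
      omega
  -- The sign change on the first tetrad is needed here: it moves the coordinate sum from −4m to 4 h
  -- 0 − 4m modulo 8, as the new residue m + h 0 requires.
  · rw [sum_eq_sum_tetrad]
    have : ∀ b, ∑ r, Leech.sextetMap x (tetrad b r) = if b = 0 then 2 * h b else - 2 * h b := by
      intro b
      have := hh b
      simp only [sextetMap_apply hh, sextet_tetrad, tetradSum, Fin.sum_univ_four] at *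
      split_ifs <;> omega
    simp only [this, Fin.sum_univ_six]
    simp only [Int.ModEq] at *
    simp
    omega

theorem sextetMap_sextetMap {x : Fin 24 → ℤ} (hx : IsLeechInt x) :
    sextetMap (sextetMap x) = x := by
  obtain ⟨h, hh, -⟩ := hx.tetradSum_eq
  have h' : ∀ b, tetradSum (sextetMap x) b = 2 * if b = 0 then h b else -h b := by
    intro b
    have := hh b
    simp only [sextetMap_apply hh, sextet_tetrad, tetradSum, Fin.sum_univ_four] at *
    split_ifs <;> omega
  funext i
  rw [sextetMap_apply h', sextetMap_apply hh]
  split_ifs <;> ring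

theorem sextetMap_sub {x y : Fin 24 → ℤ} (hx : IsLeechInt x) (hy : IsLeechInt y) :
    sextetMap (x - y) = sextetMap x - sextetMap y := by
  obtain ⟨h, hh, -⟩ := hx.tetradSum_eq
  obtain ⟨k, hk, -⟩ := hy.tetradSum_eq
  have h' : ∀ b, tetradSum (x - y) b = 2 * (h - k) b := by
    intro b
    have := hh b
    have := hk b
    simp only [tetradSum, Fin.sum_univ_four, Pi.sub_apply] at *
    omega
  funext i
  rw [Pi.sub_apply, sextetMap_apply h', sextetMap_apply hh, sextetMap_apply hk]
  simp only [Pi.sub_apply]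
  split_ifs <;> ring

/-- On each tetrad the map is, up to sign, the reflection in the all-one vector of that tetrad. -/
theorem sum_sq_sextetMap {x : Fin 24 → ℤ} (hx : IsLeechInt x) :
    ∑ i, sextetMap x i ^ 2 = ∑ i, x i ^ 2 := by
  obtain ⟨h, hh, -⟩ := hx.tetradSum_eq
  rw [sum_eq_sum_tetrad, sum_eq_sum_tetrad (fun i => x i ^ 2)]
  refine Finset.sum_congr rfl fun b _ => ?_
  have := hh b
  simp only [sextetMap_apply hh, sextet_tetrad, tetradSum, Fin.sum_univ_four] at *
  split_ifs
  · linear_combination (-2 * h b) * this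
  · linear_combination (-2 * h b) * this

/-! ### The three shapes of shortest vectors. -/

/-- The vector with one coordinate `-3` and all other coordinates `1`. -/
def oddVec (j : Fin 24) : Fin 24 → ℤ := fun i => if i = j then -3 else 1

theorem isLeechInt_oddVec (j : Fin 24) : IsLeechInt (oddVec j) := by
  refine isLeechInt_iff.2 ⟨1, 0, golayCode.zero_mem, fun i => ?_, ?_⟩
  · simp only [oddVec, Pi.zero_apply, ZMod.val_zero]
    split_ifs <;> decide
  · have : ∀ j, ∑ i, oddVec j i = 20 := by decide +kernel
    rw [this]; decide

theorem sum_sq_oddVec (j : Fin 24) : ∑ i, oddVec j i ^ 2 = 32 := by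
  revert j; decide +kernel

theorem sum_lower_bound {f g : Fin 24 → ℤ} (h : ∀ i, g i ≤ f i) :
    ∑ i, g i ≤ ∑ i, f i ∧ (∑ i, f i = ∑ i, g i → ∀ i, f i = g i) := by
  refine ⟨Finset.sum_le_sum fun i _ => h i, fun e i => ?_⟩
  exact ((Finset.sum_eq_sum_iff_of_le fun i _ => h i).1 e.symm i (Finset.mem_univ i)).symm

/-- After a sign change on a codeword all coordinates are 1 modulo 4. The sum condition modulo 8
excludes the all-one vector and forces the z i in y = 1 + 4z to have odd sum, so some |y k| is at
least 3 and the norm is at least 9 + 23 = 32. -/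
theorem IsLeechInt.odd_case {x : Fin 24 → ℤ} (hx : IsLeechInt x) {j : Fin 24}
    (hj : x j % 2 = 1) : 32 ≤ ∑ i, x i ^ 2 ∧ (∑ i, x i ^ 2 = 32 →
      ∃ w ∈ golayCode, ∃ k, x = Leech.signChange w (oddVec k)) := by
  obtain ⟨m, h1, h2, h3⟩ := id hx
  have hm : m % 2 = 1 := by have := h1 j; simp only [Int.ModEq] at this; omega
  have hw := h3 3
  set w := residueWord x 3 with hwdef
  have hy := hx.signChange hw
  have hy1 : ∀ i, Leech.signChange w x i % 4 = 1 := by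
    intro i
    have := h1 i
    by_cases h : x i ≡ 3 [ZMOD 4]
    · have : w i = 1 := by rw [hwdef, residueWord, if_pos h]
      simp only [Leech.signChange, this, if_true]
      simp only [Int.ModEq] at *; omega
    · have : w i ≠ 1 := by rw [hwdef, residueWord, if_neg h]; decide
      simp only [Leech.signChange, this, if_false]
      simp only [Int.ModEq] at *; omega
  rw [← sum_sq_signChange w x]
  have hback := signChange_signChange w x
  generalize Leech.signChange w x = y at *
  have hz : ∀ i, ∃ z, y i = 1 + 4 * z := fun i => ⟨(y i - 1) / 4, by have := hy1 i; omega⟩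
  choose z hz using hz
  obtain ⟨m', g1, g2, -⟩ := hy
  have hm' : m' % 2 = 1 := by
    have := g1 j; have := hy1 j; simp only [Int.ModEq] at *; omega
  have hsum : ∑ i, y i = 24 + 4 * ∑ i, z i := by
    simp only [hz, Finset.sum_add_distrib, ← Finset.mul_sum]; simp
  have hex : ∃ k, z k ≠ 0 := by
    by_contra! h
    simp only [h, Finset.sum_const_zero] at hsum
    simp only [Int.ModEq] at g2; omega
  obtain ⟨k, hk⟩ := hex
  have hb := sum_lower_bound (f := fun i => y i ^ 2) (g := fun i => oddVec k i ^ 2) (fun i => by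
    simp only [oddVec, hz]
    split_ifs with h
    · subst h
      rcases lt_or_gt_of_ne hk with h | h <;> nlinarith
    · rcases lt_trichotomy (z i) 0 with h | h | h
      · nlinarith
      · simp [h]
      · nlinarith)
  rw [sum_sq_oddVec] at hb
  refine ⟨hb.1, fun e => ⟨w, hw, k, ?_⟩⟩
  have : y = oddVec k := by
    funext i
    have hi := hb.2 e i
    have h1 := hy1 i
    simp only [oddVec] at hi ⊢
    split_ifs at hi ⊢
    · have : y i = 3 ∨ y i = -3 := sq_eq_sq_iff_eq_or_eq_neg.1 (by rw [hi]; norm_num)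
      omega
    · have : y i = 1 ∨ y i = -1 := sq_eq_sq_iff_eq_or_eq_neg.1 hi
      omega
  rw [← this, hback]

/-- The coordinates congruent to 2 modulo 4 form a nonzero codeword, hence number at least 8, and
each contributes at least 4. -/
theorem IsLeechInt.octad_case {x : Fin 24 → ℤ} (hx : IsLeechInt x) {j : Fin 24}
    (hj : x j % 4 = 2) : 32 ≤ ∑ i, x i ^ 2 ∧ (∑ i, x i ^ 2 = 32 →
      ∃ w ∈ golayCode, weight w = 8 ∧
        ∀ i, (w i = 1 ∧ (x i = 2 ∨ x i = -2)) ∨ (w i = 0 ∧ x i = 0)) := by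
  obtain ⟨m, h1, h2, h3⟩ := id hx
  have hm : m % 2 = 0 := by have := h1 j; simp only [Int.ModEq] at this; omega
  have hw := h3 2
  set w := residueWord x 2 with hwdef
  have h0 : w ≠ 0 := by
    intro h
    have := congrFun h j
    rw [hwdef, residueWord, if_pos (by simp only [Int.ModEq]; omega)] at this
    exact one_ne_zero this
  have h8 := eight_le_weight hw h0
  have hi1 : (1 : ZMod 2).val = 1 := rfl
  have hwi : ∀ i, (w i = 1 ∧ (w i).val = 1 ∧ x i % 4 = 2) ∨
      (w i = 0 ∧ (w i).val = 0 ∧ x i % 4 = 0) := by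
    intro i
    have := h1 i
    by_cases h : x i ≡ 2 [ZMOD 4]
    · left
      have e : w i = 1 := by rw [hwdef, residueWord, if_pos h]
      exact ⟨e, by rw [e, hi1], by simp only [Int.ModEq] at h; omega⟩
    · right
      have e : w i = 0 := by rw [hwdef, residueWord, if_neg h]
      exact ⟨e, by rw [e]; rfl, by simp only [Int.ModEq] at *; omega⟩
  have hb := sum_lower_bound (f := fun i => x i ^ 2) (g := fun i => 4 * ((w i).val : ℤ))
    (fun i => by
      rcases hwi i with ⟨_, h, h'⟩ | ⟨_, h, h'⟩
      · rw [h]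
        rcases le_or_gt (x i) 0 with hl | hl
        · have : x i ≤ -2 := by omega
          push_cast; nlinarith
        · have : 2 ≤ x i := by omega
          push_cast; nlinarith
      · rw [h]; push_cast; positivity)
  have hg : ∑ i, 4 * ((w i).val : ℤ) = 4 * weight w := by
    rw [weight_eq_sum, ← Finset.mul_sum]; push_cast; rfl
  rw [hg] at hb
  refine ⟨by omega, fun e => ⟨w, hw, by omega, fun i => ?_⟩⟩
  have hi := hb.2 (by omega) i
  rcases hwi i with ⟨h, h', -⟩ | ⟨h, h', -⟩
  · refine Or.inl ⟨h, sq_eq_sq_iff_eq_or_eq_neg.1 ?_⟩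
    rw [hi, h']; norm_num
  · refine Or.inr ⟨h, ?_⟩
    rw [h'] at hi
    exact pow_eq_zero_iff (two_ne_zero) |>.1 (by simpa using hi)

/-- With x = 4y, the sum of y is even by the condition modulo 8, hence so is the sum of squares of
y; being positive it is at least 2. -/
theorem IsLeechInt.pair_case {x : Fin 24 → ℤ} (hx : IsLeechInt x) (h4 : ∀ j, x j % 4 = 0)
    (h0 : x ≠ 0) : 32 ≤ ∑ i, x i ^ 2 ∧ (∑ i, x i ^ 2 = 32 →
      ∃ i j, i ≠ j ∧ (x i = 4 ∨ x i = -4) ∧ (x j = 4 ∨ x j = -4) ∧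
        ∀ k, k ≠ i → k ≠ j → x k = 0) := by
  obtain ⟨m, h1, h2, -⟩ := id hx
  have hm : m % 2 = 0 := by have := h4 0; have := h1 0; simp only [Int.ModEq] at this; omega
  have hy : ∀ i, ∃ y, x i = 4 * y := fun i => ⟨x i / 4, by have := h4 i; omega⟩
  choose y hy using hy
  have hs : ∑ i, x i = 4 * ∑ i, y i := by
    rw [Finset.mul_sum]; exact Finset.sum_congr rfl fun i _ => hy i
  have hss : ∑ i, x i ^ 2 = 16 * ∑ i, y i ^ 2 := by
    rw [Finset.mul_sum]; exact Finset.sum_congr rfl fun i _ => by rw [hy]; ring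
  have hpar : ∑ i, y i ^ 2 ≡ ∑ i, y i [ZMOD 2] := Int.ModEq.sum fun i _ => by
    refine (Int.emod_emod_of_dvd _ dvd_rfl).symm.trans ?_
    rcases Int.emod_two_eq_zero_or_one (y i) with h | h <;> rw [pow_two, Int.mul_emod, h] <;> rfl
  obtain ⟨i, hi⟩ : ∃ i, y i ≠ 0 := by
    by_contra! h
    exact h0 (funext fun i => by simp [hy, h])
  have sq1 : ∀ k, y k ≠ 0 → 1 ≤ y k ^ 2 := fun k hk => by
    have : 0 < y k ^ 2 := by positivity
    omega
  have hle : y i ^ 2 ≤ ∑ i, y i ^ 2 :=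
    Finset.single_le_sum (f := fun i => y i ^ 2) (fun i _ => sq_nonneg _) (Finset.mem_univ i)
  have hpos := sq1 i hi
  have h32 : 32 ≤ ∑ i, x i ^ 2 := by
    simp only [Int.ModEq] at *
    omega
  refine ⟨h32, fun e => ?_⟩
  have e2 : ∑ i, y i ^ 2 = 2 := by omega
  obtain ⟨j, hij, hj⟩ : ∃ j, j ≠ i ∧ y j ≠ 0 := by
    by_contra! h
    rw [Finset.sum_eq_single i (fun j _ hj => by simp [h j hj]) (by simp)] at e2
    have h2 : y i ≤ 2 := by nlinarith
    have h2' : -2 ≤ y i := by nlinarith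
    interval_cases y i <;> omega
  have hb := sum_lower_bound (f := fun k => y k ^ 2)
    (g := fun k => (if k = i then 1 else 0) + (if k = j then 1 else 0)) (fun k => by
      by_cases hki : k = i
      · subst hki; simpa [Ne.symm hij] using sq1 k hi
      · by_cases hkj : k = j
        · subst hkj; simpa [hki] using sq1 k hj
        · simp only [hki, hkj, if_false]; positivity)
  have hb2 := hb.2 (by rw [e2, Finset.sum_add_distrib]; simp)
  refine ⟨i, j, hij.symm, ?_, ?_, fun k hki hkj => ?_⟩
  · have := hb2 i
    simp only [if_true, if_neg hij.symm, add_zero] at this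
    rcases sq_eq_one_iff.1 this with h | h <;> simp [hy, h]
  · have := hb2 j
    simp only [if_true, if_neg hij, zero_add] at this
    rcases sq_eq_one_iff.1 this with h | h <;> simp [hy, h]
  · have := hb2 k
    simp only [if_neg hki, if_neg hkj, add_zero] at this
    rw [hy, pow_eq_zero_iff two_ne_zero |>.1 this, mul_zero]

theorem mod_four_cases (x : Fin 24 → ℤ) :
    (∃ j, x j % 2 = 1) ∨ (∃ j, x j % 4 = 2) ∨ ∀ j, x j % 4 = 0 := by
  by_cases h1 : ∃ j, x j % 2 = 1
  · exact Or.inl h1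
  by_cases h2 : ∃ j, x j % 4 = 2
  · exact Or.inr (Or.inl h2)
  push Not at h1 h2
  exact Or.inr (Or.inr fun j => by have := h1 j; have := h2 j; omega)

theorem IsLeechInt.sum_sq_ge {x : Fin 24 → ℤ} (hx : IsLeechInt x) (h0 : x ≠ 0) :
    32 ≤ ∑ i, x i ^ 2 := by
  rcases mod_four_cases x with ⟨j, hj⟩ | ⟨j, hj⟩ | h
  · exact (hx.odd_case hj).1
  · exact (hx.octad_case hj).1
  · exact (hx.pair_case h h0).1

/-! ### Passage to Euclidean space and transitivity of `Co0` on minimal vectors. -/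

noncomputable section

/-- The lattice vector with given integral coordinates. -/
def ofInt (x : Fin 24 → ℤ) (hx : IsLeechInt x) : leechLattice :=
  ⟨WithLp.toLp 2 fun i => (x i : ℝ) / √8, x, hx, fun _ => rfl⟩

theorem exists_eq_ofInt (v : leechLattice) : ∃ x hx, v = ofInt x hx := by
  obtain ⟨v, x, hx, h⟩ := v
  exact ⟨x, hx, Subtype.ext (PiLp.ext h)⟩

theorem ofInt_injective {x y : Fin 24 → ℤ} {hx : IsLeechInt x} {hy : IsLeechInt y}
    (h : ofInt x hx = ofInt y hy) : x = y := by
  funext i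
  have h1 : (x i : ℝ) / √8 = y i / √8 :=
    congrArg (fun v : leechLattice => (v : EuclideanSpace ℝ (Fin 24)) i) h
  have : √8 ≠ 0 := by positivity
  exact_mod_cast (div_left_inj' this).1 h1

theorem ofInt_congr {x y : Fin 24 → ℤ} (h : x = y) (hx : IsLeechInt x) (hy : IsLeechInt y) :
    ofInt x hx = ofInt y hy := by
  subst h; rfl

theorem IsLeechInt.sub {x y : Fin 24 → ℤ} (hx : IsLeechInt x) (hy : IsLeechInt y) :
    IsLeechInt (x - y) := sub_eq_add_neg x y ▸ hx.add hy.neg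

theorem ofInt_sub {x y : Fin 24 → ℤ} (hx : IsLeechInt x) (hy : IsLeechInt y) :
    ofInt x hx - ofInt y hy = ofInt (x - y) (hx.sub hy) := by
  refine Subtype.ext (PiLp.ext fun i => ?_)
  simp [ofInt, sub_div]

theorem ofInt_zero : ofInt 0 IsLeechInt.zero = 0 := by
  refine Subtype.ext (PiLp.ext fun i => ?_)
  simp [ofInt]

theorem inner_ofInt {x y : Fin 24 → ℤ} (hx : IsLeechInt x) (hy : IsLeechInt y) :
    inner ℝ (ofInt x hx : EuclideanSpace ℝ (Fin 24)) (ofInt y hy) =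
      ((∑ i, x i * y i : ℤ) : ℝ) / 8 := by
  have h8 : √8 * √8 = 8 := Real.mul_self_sqrt (by norm_num)
  simp only [ofInt, PiLp.inner_apply, RCLike.inner_apply, conj_trivial]
  push_cast
  rw [Finset.sum_div]
  refine Finset.sum_congr rfl fun i _ => ?_
  rw [div_mul_div_comm, h8, mul_comm]

theorem norm_sq_ofInt {x : Fin 24 → ℤ} (hx : IsLeechInt x) :
    ‖ofInt x hx‖ ^ 2 = ((∑ i, x i ^ 2 : ℤ) : ℝ) / 8 := by
  rw [← AddSubgroup.norm_coe, ← real_inner_self_eq_norm_sq, inner_ofInt]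
  simp only [pow_two]

theorem norm_ofInt_le_iff {x y : Fin 24 → ℤ} (hx : IsLeechInt x) (hy : IsLeechInt y) :
    ‖ofInt x hx‖ ≤ ‖ofInt y hy‖ ↔ ∑ i, x i ^ 2 ≤ ∑ i, y i ^ 2 := by
  rw [← sq_le_sq₀ (norm_nonneg _) (norm_nonneg _), norm_sq_ofInt, norm_sq_ofInt,
    div_le_div_iff_of_pos_right (by norm_num)]
  exact Int.cast_le

theorem ofInt_mem_minimalVectors {x : Fin 24 → ℤ} (hx : IsLeechInt x) :
    ofInt x hx ∈ minimalVectors ↔ ∑ i, x i ^ 2 = 32 := by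
  constructor
  · rintro ⟨h0, h⟩
    have hx0 : x ≠ 0 := by
      rintro rfl; exact h0 ofInt_zero
    have hne : ofInt _ (isLeechInt_oddVec 0) ≠ 0 := by
      rw [← ofInt_zero]
      intro h
      have := congrFun (ofInt_injective h) 0
      simp [oddVec] at this
    have := (norm_ofInt_le_iff hx _).1 (h _ hne)
    rw [sum_sq_oddVec] at this
    exact le_antisymm this (hx.sum_sq_ge hx0)
  · intro h
    refine ⟨fun h0 => ?_, fun v hv => ?_⟩
    · rw [← ofInt_zero] at h0
      have := ofInt_injective h0
      subst this
      simp at h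
    · obtain ⟨y, hy, rfl⟩ := exists_eq_ofInt v
      rw [norm_ofInt_le_iff, h]
      refine hy.sum_sq_ge ?_
      rintro rfl
      exact hv ofInt_zero

/-- Two integral coordinate vectors describe lattice vectors in the same orbit of `Co₀`. -/
def SameOrbit (x y : Fin 24 → ℤ) : Prop :=
  ∃ (hx : IsLeechInt x) (hy : IsLeechInt y) (g : Co0),
    (g : leechLattice ≃ᵢ leechLattice) (ofInt x hx) = ofInt y hy

theorem SameOrbit.symm {x y : Fin 24 → ℤ} (h : SameOrbit x y) : SameOrbit y x := by
  obtain ⟨hx, hy, g, hg⟩ := h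
  refine ⟨hy, hx, g⁻¹, ?_⟩
  rw [← hg]
  exact (g : leechLattice ≃ᵢ leechLattice).symm_apply_apply _

theorem SameOrbit.trans {x y z : Fin 24 → ℤ} (h : SameOrbit x y) (h' : SameOrbit y z) :
    SameOrbit x z := by
  obtain ⟨hx, hy, g, hg⟩ := h
  obtain ⟨_, hz, g', hg'⟩ := h'
  refine ⟨hx, hz, g' * g, ?_⟩
  rw [← hg', ← hg]; rfl

theorem sameOrbit_of_isometry {f g : (Fin 24 → ℤ) → (Fin 24 → ℤ)}
    (hf : ∀ x, IsLeechInt x → IsLeechInt (f x)) (hg : ∀ x, IsLeechInt x → IsLeechInt (g x))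
    (hgf : ∀ x, IsLeechInt x → g (f x) = x) (hfg : ∀ x, IsLeechInt x → f (g x) = x)
    (hsub : ∀ x y, IsLeechInt x → IsLeechInt y → f (x - y) = f x - f y)
    (hnorm : ∀ x, IsLeechInt x → ∑ i, f x i ^ 2 = ∑ i, x i ^ 2)
    {x : Fin 24 → ℤ} (hx : IsLeechInt x) : SameOrbit x (f x) := by
  choose c hc hcv using exists_eq_ofInt
  have hc' : ∀ x hx, c (ofInt x hx) = x := fun x hx => (ofInt_injective (hcv (ofInt x hx))).symm
  let G : leechLattice ≃ᵢ leechLattice :=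
    { toFun := fun v => ofInt (f (c v)) (hf _ (hc v))
      invFun := fun v => ofInt (g (c v)) (hg _ (hc v))
      left_inv := fun v => by
        refine (ofInt_congr ?_ _ (hc v)).trans (hcv v).symm
        change g (c (ofInt (f (c v)) (hf _ (hc v)))) = c v
        rw [hc', hgf _ (hc v)]
      right_inv := fun v => by
        refine (ofInt_congr ?_ _ (hc v)).trans (hcv v).symm
        change f (c (ofInt (g (c v)) (hg _ (hc v)))) = c v
        rw [hc', hfg _ (hc v)]
      isometry_toFun := by
        refine Isometry.of_dist_eq fun v w => ?_
        rw [dist_eq_norm, dist_eq_norm, ofInt_sub]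
        conv_rhs => rw [hcv v, hcv w, ofInt_sub]
        rw [← sq_eq_sq₀ (norm_nonneg _) (norm_nonneg _), norm_sq_ofInt, norm_sq_ofInt,
          ← hnorm _ ((hc v).sub (hc w)), hsub _ _ (hc v) (hc w)] }
  have h0 : G 0 = 0 := by
    change ofInt (f (c 0)) (hf _ (hc 0)) = 0
    have hf0 : f 0 = 0 := by simpa using hsub 0 0 IsLeechInt.zero IsLeechInt.zero
    rw [ofInt_congr (y := 0) _ _ IsLeechInt.zero, ofInt_zero]
    rw [← ofInt_zero, hc', hf0]
  refine ⟨hx, hf x hx, ⟨G, h0⟩, ?_⟩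
  change ofInt (f (c (ofInt x hx))) (hf _ (hc _)) = _
  exact ofInt_congr (congrArg f (hc' x hx)) _ _

theorem sameOrbit_signChange {w : Fin 24 → ZMod 2} (hw : w ∈ golayCode) {x : Fin 24 → ℤ}
    (hx : IsLeechInt x) : SameOrbit x (signChange w x) :=
  sameOrbit_of_isometry (f := signChange w) (g := signChange w)
    (fun _ h => h.signChange hw) (fun _ h => h.signChange hw)
    (fun x _ => signChange_signChange w x) (fun x _ => signChange_signChange w x)
    (fun x y _ _ => signChange_sub w x y) (fun x _ => sum_sq_signChange w x) hx

theorem sameOrbit_sextetMap {x : Fin 24 → ℤ} (hx : IsLeechInt x) : SameOrbit x (sextetMap x) :=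
  sameOrbit_of_isometry (f := sextetMap) (g := sextetMap)
    (fun _ h => h.sextetMap) (fun _ h => h.sextetMap)
    (fun _ h => sextetMap_sextetMap h) (fun _ h => sextetMap_sextetMap h)
    (fun _ _ h h' => sextetMap_sub h h') (fun _ h => sum_sq_sextetMap h) hx

theorem sameOrbit_comp_cyc {x : Fin 24 → ℤ} (hx : IsLeechInt x) : SameOrbit x (x ∘ cyc) := by
  have inv : ∀ i, (cyc ^ 22) (cyc i) = i := fun i => by
    rw [← Equiv.Perm.mul_apply, ← pow_succ, cyc_pow_23]; rfl
  have inv' : ∀ i, cyc ((cyc ^ 22) i) = i := fun i => by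
    rw [← Equiv.Perm.mul_apply, ← pow_succ', cyc_pow_23]; rfl
  exact sameOrbit_of_isometry (f := fun x => x ∘ cyc)
    (g := fun x => x ∘ (cyc ^ 22 : Equiv.Perm (Fin 24)))
    (fun _ h => h.comp_cyc) (fun _ h => h.comp_cyc_pow 22)
    (fun x _ => funext fun i => by simp [inv']) (fun x _ => funext fun i => by simp [inv])
    (fun x y _ _ => rfl) (fun x _ => Equiv.sum_comp cyc fun i => x i ^ 2) hx

theorem sameOrbit_comp_cyc_pow {x : Fin 24 → ℤ} (hx : IsLeechInt x) (a : ℕ) :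
    SameOrbit x (x ∘ (cyc ^ a : Equiv.Perm (Fin 24))) := by
  induction a with
  | zero => exact ⟨hx, hx, 1, rfl⟩
  | succ a ih => rw [pow_succ]; exact ih.trans (sameOrbit_comp_cyc (hx.comp_cyc_pow a))

theorem word_mem {n : ℕ} (h : n ∈ golayNat) : word n ∈ golayCode := mem_golayCode_iff.2 ⟨n, h, rfl⟩

theorem sameOrbit_oddVec (j : Fin 24) : SameOrbit (oddVec j) (oddVec 0) := by
  have small : ∀ n (h : n < 23), SameOrbit (oddVec ⟨n, by omega⟩) (oddVec 0) := by
    intro n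
    induction n with
    | zero => exact fun _ => ⟨isLeechInt_oddVec _, isLeechInt_oddVec _, 1, rfl⟩
    | succ n ih =>
      intro h
      have e : oddVec ⟨n + 1, by omega⟩ ∘ cyc = oddVec ⟨n, by omega⟩ := by
        have : cyc ⟨n, by omega⟩ = ⟨n + 1, by omega⟩ := by
          simp only [cyc, Equiv.coe_fn_mk]
          rw [dif_pos (by omega)]
          ext; simp; omega
        funext i
        simp only [oddVec, Function.comp_apply, ← this, cyc.apply_eq_iff_eq]
      have := sameOrbit_comp_cyc (isLeechInt_oddVec ⟨n + 1, by omega⟩)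
      rw [e] at this
      exact this.trans (ih (by omega))
  by_cases h : j.val < 23
  · exact small _ h
  -- The shift fixes the point at infinity, so another symmetry is needed. Coordinates 0 and 23 lie
  -- in one tetrad; after a common sign change, `sextetMap` sends both vectors to vectors that
  -- differ only by signs on a codeword.
  · obtain rfl : j = 23 := by ext; simp; omega
    have m1 : word 4845570 ∈ golayCode := word_mem (by decide +kernel)
    have m2 : word 13893731 ∈ golayCode := word_mem (by decide +kernel)
    have e : signChange (word 13893731) (sextetMap (signChange (word 4845570) (oddVec 23))) =
        sextetMap (signChange (word 4845570) (oddVec 0)) := by decide +kernel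
    have h1 := (isLeechInt_oddVec 23).signChange m1
    have h2 := (isLeechInt_oddVec 0).signChange m1
    have s1 := ((sameOrbit_signChange m1 (isLeechInt_oddVec 23)).trans
      (sameOrbit_sextetMap h1)).trans (sameOrbit_signChange m2 h1.sextetMap)
    rw [e] at s1
    exact s1.trans ((sameOrbit_signChange m1 (isLeechInt_oddVec 0)).trans
      (sameOrbit_sextetMap h2)).symm

theorem SameOrbit.sum_sq {x y : Fin 24 → ℤ} (h : SameOrbit x y) :
    ∑ i, y i ^ 2 = ∑ i, x i ^ 2 := by
  obtain ⟨hx, hy, g, hg⟩ := h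
  have hd := (g : leechLattice ≃ᵢ leechLattice).dist_eq (ofInt x hx) 0
  rw [show (g : leechLattice ≃ᵢ leechLattice) 0 = 0 from g.2, hg, dist_zero_right,
    dist_zero_right] at hd
  have := congrArg (· ^ 2) hd
  simp only [norm_sq_ofInt] at this
  have := (div_left_inj' (by norm_num : (8 : ℝ) ≠ 0)).1 this
  exact_mod_cast this

theorem sameOrbit_of_odd {x : Fin 24 → ℤ} (hx : IsLeechInt x) (h32 : ∑ i, x i ^ 2 = 32)
    {j : Fin 24} (hj : x j % 2 = 1) : SameOrbit x (oddVec 0) := by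
  obtain ⟨w, hw, k, rfl⟩ := (hx.odd_case hj).2 h32
  exact (sameOrbit_signChange hw (isLeechInt_oddVec k)).symm.trans (sameOrbit_oddVec k)

/-- A shift makes the octad meet the tetrads oddly, and `sextetMap` then gives a vector of odd type.
One odd coordinate, in tetrad 1, is enough to recognise it. -/
theorem sameOrbit_of_octad {x : Fin 24 → ℤ} (hx : IsLeechInt x) (h32 : ∑ i, x i ^ 2 = 32)
    {j : Fin 24} (hj : x j % 4 = 2) : SameOrbit x (oddVec 0) := by
  obtain ⟨w, hw, h8, h⟩ := (hx.octad_case hj).2 h32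
  obtain ⟨a, ha⟩ := exists_shift_odd hw h8
  have s1 := sameOrbit_comp_cyc_pow hx a
  have hy := hx.comp_cyc_pow a
  have s2 := s1.trans (sameOrbit_sextetMap hy)
  refine s2.trans (sameOrbit_of_odd hy.sextetMap (j := tetrad 1 0) (by rw [s2.sum_sq, h32]) ?_)
  obtain ⟨t, ht, -⟩ := hy.tetradSum_eq
  rw [sextetMap_apply ht, sextet_tetrad, if_neg (by decide)]
  have h1 := ht 1
  have a1 := ha 1
  have hi1 : (1 : ZMod 2).val = 1 := rfl
  have hv : ∀ i, x i % 4 = 2 * (w i).val ∧ ((w i).val < 2) := by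
    intro i
    rcases h i with ⟨h, h' | h'⟩ | ⟨h, h'⟩ <;> rw [h, h'] <;> simp [hi1]
  have a2 : (w ((cyc ^ a) (tetrad 1 0)) + w ((cyc ^ a) (tetrad 1 1)) +
      w ((cyc ^ a) (tetrad 1 2)) + w ((cyc ^ a) (tetrad 1 3))).val = 1 := by
    rw [Fin.sum_univ_four] at a1
    rw [a1, hi1]
  simp only [ZMod.val_add] at a2
  have v0 := hv ((cyc ^ a) (tetrad 1 0))
  have v1 := hv ((cyc ^ a) (tetrad 1 1))
  have v2 := hv ((cyc ^ a) (tetrad 1 2))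
  have v3 := hv ((cyc ^ a) (tetrad 1 3))
  simp only [tetradSum, Fin.sum_univ_four, Function.comp_apply] at h1 ⊢
  omega

theorem exists_shift_separated : ∀ i j : Fin 24, i ≠ j → ∃ a : Fin 23,
    sextet ((cyc ^ a.val)⁻¹ i) ≠ sextet ((cyc ^ a.val)⁻¹ j) := by
  decide +kernel

/-- A shift puts the two nonzero coordinates into different tetrads. The tetrad sum at p is then ±4,
and subtracting half of it turns ±4 into ±2, which gives octad type. -/
theorem sameOrbit_of_pair {x : Fin 24 → ℤ} (hx : IsLeechInt x) (h32 : ∑ i, x i ^ 2 = 32)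
    (h4 : ∀ j, x j % 4 = 0) : SameOrbit x (oddVec 0) := by
  have h0 : x ≠ 0 := by rintro rfl; simp at h32
  obtain ⟨i, j, hij, hi, -, h⟩ := (hx.pair_case h4 h0).2 h32
  obtain ⟨a, ha⟩ := exists_shift_separated i j hij
  have hp : (cyc ^ a.val) ((cyc ^ a.val)⁻¹ i) = i := (cyc ^ a.val).apply_symm_apply i
  have hq : (cyc ^ a.val) ((cyc ^ a.val)⁻¹ j) = j := (cyc ^ a.val).apply_symm_apply j
  generalize (cyc ^ a.val)⁻¹ i = p at *
  generalize (cyc ^ a.val)⁻¹ j = q at *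
  have s1 := sameOrbit_comp_cyc_pow hx a
  have hy := hx.comp_cyc_pow a
  have s2 := s1.trans (sameOrbit_sextetMap hy)
  refine s2.trans (sameOrbit_of_octad hy.sextetMap (j := p) (by rw [s2.sum_sq, h32]) ?_)
  obtain ⟨t, ht, -⟩ := hy.tetradSum_eq
  rw [sextetMap_apply ht]
  have e : tetradSum (x ∘ (cyc ^ a.val : Equiv.Perm (Fin 24))) (sextet p) = x i := by
    rw [tetradSum, ← sum_sextet, Finset.sum_eq_single p]
    · simp [hp]
    · intro k _ hk
      split_ifs with hs
      · refine h _ (fun h => hk ?_) (fun h => ha ?_)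
        · exact (cyc ^ a.val).injective (h.trans hp.symm)
        · rw [← (cyc ^ a.val).injective (h.trans hq.symm), hs]
      · rfl
    · simp
  rw [ht] at e
  simp only [Function.comp_apply, hp]
  split_ifs <;> omega

theorem exists_Co0_apply_eq {v w : leechLattice} (hv : v ∈ minimalVectors)
    (hw : w ∈ minimalVectors) : ∃ g : Co0, (g : leechLattice ≃ᵢ leechLattice) v = w := by
  obtain ⟨x, hx, rfl⟩ := exists_eq_ofInt v
  obtain ⟨y, hy, rfl⟩ := exists_eq_ofInt w
  rw [ofInt_mem_minimalVectors] at hv hw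
  have key : ∀ x, IsLeechInt x → ∑ i, x i ^ 2 = 32 → SameOrbit x (oddVec 0) := by
    intro x hx h
    rcases mod_four_cases x with ⟨j, hj⟩ | ⟨j, hj⟩ | h4
    · exact sameOrbit_of_odd hx h hj
    · exact sameOrbit_of_octad hx h hj
    · exact sameOrbit_of_pair hx h h4
  obtain ⟨_, _, g, hg⟩ := (key x hx hv).trans (key y hy hw).symm
  exact ⟨g, hg⟩

end

/-! ### Oddness of the elements of `Co0`, finiteness of 𝒞 and of `Co0`. -/

theorem Co0_map_zero (g : Co0) : (g : leechLattice ≃ᵢ leechLattice) 0 = 0 := g.2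

theorem Co0_norm_map (g : Co0) (v : leechLattice) :
    ‖(g : leechLattice ≃ᵢ leechLattice) v‖ = ‖v‖ := by
  have := (g : leechLattice ≃ᵢ leechLattice).dist_eq v 0
  rwa [Co0_map_zero, dist_zero_right, dist_zero_right] at this

theorem Co0_inner_map (g : Co0) (v w : leechLattice) :
    inner ℝ ((g : leechLattice ≃ᵢ leechLattice) v : EuclideanSpace ℝ (Fin 24))
      ((g : leechLattice ≃ᵢ leechLattice) w) = inner ℝ (v : EuclideanSpace ℝ (Fin 24)) w := by
  have h := (g : leechLattice ≃ᵢ leechLattice).dist_eq v w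
  rw [dist_eq_norm, dist_eq_norm] at h
  have h1 := Co0_norm_map g v
  have h2 := Co0_norm_map g w
  simp only [← AddSubgroup.norm_coe, AddSubgroup.coe_sub] at h h1 h2
  rw [real_inner_eq_norm_mul_self_add_norm_mul_self_sub_norm_sub_mul_self_div_two,
    real_inner_eq_norm_mul_self_add_norm_mul_self_sub_norm_sub_mul_self_div_two, h, h1, h2]

/-- Elements of `Co0` are only assumed to be isometries fixing 0. Preservation of inner products
gives |g(−v) + g(v)|² = 0. -/
theorem Co0_map_neg (g : Co0) (v : leechLattice) :
    (g : leechLattice ≃ᵢ leechLattice) (-v) = -(g : leechLattice ≃ᵢ leechLattice) v := by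
  have h := Co0_inner_map g (-v) v
  have h1 := Co0_norm_map g v
  have h2 := Co0_norm_map g (-v)
  rw [norm_neg] at h2
  simp only [← AddSubgroup.norm_coe] at h1 h2
  rw [AddSubgroup.coe_neg, inner_neg_left, real_inner_self_eq_norm_sq] at h
  refine eq_neg_of_add_eq_zero_left (Subtype.ext ?_)
  rw [AddSubgroup.coe_add, AddSubgroup.coe_zero, ← norm_eq_zero, ← pow_eq_zero_iff two_ne_zero,
    norm_add_sq_real, h, h1, h2]
  ring

theorem Co0_map_mem_minimalVectors (g : Co0) {v : leechLattice} (hv : v ∈ minimalVectors) :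
    (g : leechLattice ≃ᵢ leechLattice) v ∈ minimalVectors := by
  refine ⟨fun h => hv.1 ?_, fun w hw => by rw [Co0_norm_map]; exact hv.2 w hw⟩
  rw [← Co0_map_zero g] at h
  exact (g : leechLattice ≃ᵢ leechLattice).injective h

theorem finite_norm_le (R : ℕ) : {v : leechLattice | ‖v‖ ^ 2 * 8 ≤ R}.Finite := by
  choose c hc hcv using exists_eq_ofInt
  have hinj : Function.Injective c := fun v w h => by
    rw [hcv v, hcv w]; exact ofInt_congr h _ _
  refine ((Set.finite_Icc (fun _ => -(R : ℤ)) (fun _ => (R : ℤ))).preimage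
    (f := c) hinj.injOn).subset fun v hv => ?_
  have h : ‖v‖ ^ 2 * 8 ≤ R := hv
  rw [hcv v, norm_sq_ofInt, div_mul_cancel₀ _ (by norm_num)] at h
  have h' : ∑ i, c v i ^ 2 ≤ R := by exact_mod_cast h
  have hi : ∀ i, |c v i| ≤ R := fun i => by
    have : c v i ^ 2 ≤ ∑ i, c v i ^ 2 :=
      Finset.single_le_sum (f := fun i => c v i ^ 2) (fun i _ => sq_nonneg _) (Finset.mem_univ i)
    exact ((Int.le_self_sq _).trans (sq_abs _).le).trans (this.trans h')
  exact ⟨fun i => (abs_le.1 (hi i)).1, fun i => (abs_le.1 (hi i)).2⟩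

theorem finite_minimalVectors : minimalVectors.Finite := by
  refine (finite_norm_le 32).subset fun v hv => ?_
  obtain ⟨x, hx, rfl⟩ := exists_eq_ofInt v
  have := (ofInt_mem_minimalVectors hx).1 hv
  simp only [Set.mem_ofPred_eq, norm_sq_ofInt, this]
  norm_num

theorem isLeechInt_single (i : Fin 24) : IsLeechInt (Pi.single i 8) := by
  refine isLeechInt_iff.2 ⟨0, 0, golayCode.zero_mem, fun k => ?_, ?_⟩
  · by_cases h : k = i
    · subst h; simp [Int.ModEq]
    · simp [h]
  · simp [Int.ModEq]

/-- An element is determined by the images of the 24 vectors with a single integral coordinate 8,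
since inner products with them read off coordinates; these images lie in a finite ball of the
lattice. -/
instance finite_Co0 : Finite Co0 := by
  have hn : ∀ (g : Co0) i, (g : leechLattice ≃ᵢ leechLattice) (ofInt _ (isLeechInt_single i)) ∈
      {v : leechLattice | ‖v‖ ^ 2 * 8 ≤ (64 : ℕ)} := by
    intro g i
    have : ∑ k, (Pi.single i 8 : Fin 24 → ℤ) k ^ 2 = 64 := by
      rw [Finset.sum_eq_single i (fun k _ hk => by simp [hk]) (by simp)]; simp
    simp only [Set.mem_ofPred_eq, Co0_norm_map, norm_sq_ofInt, this]
    norm_num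
  have := (finite_norm_le 64).to_subtype
  refine Finite.of_injective (β := Fin 24 → {v : leechLattice | ‖v‖ ^ 2 * 8 ≤ (64 : ℕ)})
    (fun g i => ⟨_, hn g i⟩) fun g h hgh => ?_
  refine Subtype.ext (IsometryEquiv.ext fun v => ?_)
  have key : ∀ u : Co0, (∀ i, (u : leechLattice ≃ᵢ leechLattice) (ofInt _ (isLeechInt_single i)) =
      ofInt _ (isLeechInt_single i)) → (u : leechLattice ≃ᵢ leechLattice) v = v := by
    intro u hu
    obtain ⟨x, hx, rfl⟩ := exists_eq_ofInt v
    obtain ⟨y, hy, e⟩ := exists_eq_ofInt ((u : leechLattice ≃ᵢ leechLattice) (ofInt x hx))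
    rw [e]
    refine ofInt_congr (funext fun i => ?_) _ _
    have := Co0_inner_map u (ofInt x hx) (ofInt _ (isLeechInt_single i))
    rw [hu, e, inner_ofInt, inner_ofInt] at this
    simpa [Pi.single_apply] using this
  have := key (h⁻¹ * g) fun i => by
    have hi := congrArg Subtype.val (congrFun hgh i)
    change (h : leechLattice ≃ᵢ leechLattice).symm ((g : leechLattice ≃ᵢ leechLattice) _) = _
    simp only at hi
    rw [hi, IsometryEquiv.symm_apply_apply]
  change (h : leechLattice ≃ᵢ leechLattice).symm ((g : leechLattice ≃ᵢ leechLattice) v) = v at this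
  exact ((h : leechLattice ≃ᵢ leechLattice).symm_apply_eq).1 this

/-! ### A lower bound for the number of minimal vectors. -/

/-- The minimal vectors of odd type, in integral coordinates. -/
def oddVectors : Finset (Fin 24 → ℤ) :=
  (Finset.univ ×ˢ golayFinset).image fun p => signChange p.2 (oddVec p.1)

theorem card_oddVectors : oddVectors.card = 24 * 4096 := by
  rw [oddVectors, Finset.card_image_of_injOn, Finset.card_product, card_golayFinset,
    Finset.card_univ, Fintype.card_fin]
  have two : ∀ z : ZMod 2, z = 0 ∨ z = 1 := by decide
  rintro ⟨i, w⟩ - ⟨j, w'⟩ - h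
  have hk : ∀ k, signChange w (oddVec i) k = signChange w' (oddVec j) k := congrFun h
  simp only [signChange, oddVec] at hk
  have hij : i = j := by
    have := hk i
    by_contra hij
    simp only [if_true, if_neg hij] at this
    split_ifs at this <;> omega
  have hw : w = w' := by
    funext k
    have := hk k
    rcases two (w k) with h1 | h1 <;> rcases two (w' k) with h2 | h2 <;> rw [h1, h2] <;>
      simp only [h1, h2, hij, zero_ne_one, if_true, if_false] at this <;>
      split_ifs at this <;> omega
  rw [hij, hw]

/-- The vector with entries `-2` on `A`, and `2` elsewhere on the support of `w`. -/
def octadVec (w : Fin 24 → ZMod 2) (A : Finset (Fin 24)) : Fin 24 → ℤ := fun k =>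
  if w k = 1 then (if k ∈ A then -2 else 2) else 0

/-- The octads together with their subsets of even cardinality. -/
def signedOctads : Finset ((_ : Fin 24 → ZMod 2) × Finset (Fin 24)) :=
  (golayFinset.filter fun w => weight w = 8).sigma fun w =>
    (Finset.univ.filter fun i => w i = 1).powerset.filter fun A => Even A.card

/-- The minimal vectors supported on octads, in integral coordinates. -/
def octadVectors : Finset (Fin 24 → ℤ) := signedOctads.image fun p => octadVec p.1 p.2

theorem card_even_subsets {s : Finset (Fin 24)} (hs : s.card = 8) :
    (s.powerset.filter fun A => Even A.card).card = 128 := by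
  rw [Finset.card_filter, Finset.sum_powerset_apply_card (fun n => if Even n then 1 else 0), hs]
  simp [Finset.sum_range_succ, Nat.choose, parity_simps]

theorem card_octadVectors : octadVectors.card = 759 * 128 := by
  have two : ∀ z : ZMod 2, z = 0 ∨ z = 1 := by decide
  rw [octadVectors, Finset.card_image_of_injOn, signedOctads, Finset.card_sigma,
    Finset.sum_congr rfl (g := fun _ => 128), Finset.sum_const, card_octads, smul_eq_mul]
  · exact fun w hw => card_even_subsets (Finset.mem_filter.1 hw).2
  · rintro ⟨w, A⟩ hA ⟨w', A'⟩ hA' h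
    have hk : ∀ k, octadVec w A k = octadVec w' A' k := congrFun h
    have hw : w = w' := by
      funext k
      have := hk k
      rcases two (w k) with h1 | h1 <;> rcases two (w' k) with h2 | h2 <;> rw [h1, h2] <;>
        simp only [octadVec, h1, h2, zero_ne_one, if_true, if_false] at this <;>
        split_ifs at this <;> omega
    subst hw
    have sub : ∀ A, (⟨w, A⟩ : (_ : Fin 24 → ZMod 2) × Finset (Fin 24)) ∈ signedOctads →
        ∀ k ∈ A, w k = 1 := by
      intro A hA k hk
      rw [signedOctads, Finset.mem_sigma, Finset.mem_filter, Finset.mem_filter, Finset.mem_powerset] at hA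
      simpa using hA.2.1 hk
    have : A = A' := by
      ext k
      have e := hk k
      simp only [octadVec] at e
      constructor <;> intro hm
      · rw [if_pos (sub A hA k hm), if_pos (sub A hA k hm), if_pos hm] at e
        by_contra hm'
        rw [if_neg hm'] at e; omega
      · rw [if_pos (sub A' hA' k hm), if_pos (sub A' hA' k hm), if_pos hm] at e
        by_contra hm'
        rw [if_neg hm'] at e; omega
    rw [this]

/-- The minimal vectors with one coordinate `4` and one coordinate `-4`, in integral coordinates. -/
def pairVectors : Finset (Fin 24 → ℤ) :=
  (Finset.univ : Finset (Fin 24)).offDiag.image fun p => Pi.single p.1 4 - Pi.single p.2 4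

theorem card_pairVectors : pairVectors.card = 552 := by
  rw [pairVectors, Finset.card_image_of_injOn, Finset.offDiag_card, Finset.card_univ,
    Fintype.card_fin]
  rintro ⟨i, j⟩ hij ⟨k, l⟩ hkl h
  have hij : i ≠ j := by simpa using hij
  have hkl : k ≠ l := by simpa using hkl
  have h1 := congrFun h i
  have h2 := congrFun h j
  simp only [Pi.sub_apply, Pi.single_apply, if_neg hij, if_neg hij.symm, if_true] at h1 h2
  have e1 : i = k := by by_contra hh; rw [if_neg hh] at h1; split_ifs at h1 <;> omega
  have e2 : j = l := by by_contra hh; rw [if_neg hh] at h2; split_ifs at h2 <;> omega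
  rw [e1, e2]

theorem minimal_of_mem_oddVectors {x : Fin 24 → ℤ} (h : x ∈ oddVectors) :
    IsLeechInt x ∧ ∑ i, x i ^ 2 = 32 := by
  obtain ⟨⟨i, w⟩, hp, rfl⟩ := Finset.mem_image.1 h
  have hw := mem_golayFinset.1 (Finset.mem_product.1 hp).2
  exact ⟨(isLeechInt_oddVec i).signChange hw, by rw [sum_sq_signChange, sum_sq_oddVec]⟩

theorem minimal_of_mem_octadVectors {x : Fin 24 → ℤ} (h : x ∈ octadVectors) :
    IsLeechInt x ∧ ∑ i, x i ^ 2 = 32 := by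
  obtain ⟨⟨w, A⟩, hp, rfl⟩ := Finset.mem_image.1 h
  simp only [signedOctads, Finset.mem_sigma, Finset.mem_filter, Finset.mem_powerset,
    mem_golayFinset] at hp
  obtain ⟨⟨hw, h8⟩, hA, hev⟩ := hp
  have two : ∀ z : ZMod 2, z = 0 ∨ z = 1 := by decide
  have hi1 : (1 : ZMod 2).val = 1 := rfl
  have hsub : ∀ k ∈ A, w k = 1 := fun k hk => by simpa using hA hk
  have h8' : ∑ i, (if w i = 1 then 1 else 0 : ℤ) = 8 := by
    rw [Finset.sum_boole]; exact_mod_cast h8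
  refine ⟨isLeechInt_iff.2 ⟨0, w, hw, fun k => ?_, ?_⟩, ?_⟩
  · rcases two (w k) with h | h
    · simp [octadVec, h]
    · simp only [octadVec, h, if_true, hi1]; split_ifs <;> decide
  · have : ∑ k, octadVec w A k = 2 * 8 - 4 * A.card := by
      have hc : (A.card : ℤ) = ∑ k, if k ∈ A then 1 else 0 := by simp
      rw [← h8', hc, Finset.mul_sum, Finset.mul_sum, ← Finset.sum_sub_distrib]
      refine Finset.sum_congr rfl fun k _ => ?_
      by_cases hk : k ∈ A
      · simp [octadVec, hk, hsub k hk]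
      · simp [octadVec, hk]
    obtain ⟨r, hr⟩ := hev
    change ∑ k, octadVec w A k ≡ _ [ZMOD 8]
    rw [this, hr]
    simp only [Int.ModEq]; push_cast; omega
  · have : ∀ k, octadVec w A k ^ 2 = 4 * (if w k = 1 then 1 else 0 : ℤ) := by
      intro k
      simp only [octadVec]; split_ifs <;> norm_num
    change ∑ k, octadVec w A k ^ 2 = 32
    simp only [this, ← Finset.mul_sum, h8']; norm_num

theorem minimal_of_mem_pairVectors {x : Fin 24 → ℤ} (h : x ∈ pairVectors) :
    IsLeechInt x ∧ ∑ i, x i ^ 2 = 32 := by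
  obtain ⟨⟨i, j⟩, hp, rfl⟩ := Finset.mem_image.1 h
  have hij : i ≠ j := by simpa using hp
  refine ⟨isLeechInt_iff.2 ⟨0, 0, golayCode.zero_mem, fun k => ?_, ?_⟩, ?_⟩
  · simp only [Pi.sub_apply, Pi.single_apply, Pi.zero_apply, ZMod.val_zero]
    split_ifs <;> decide
  · simp [Finset.sum_sub_distrib]
  · have : ∀ k, (Pi.single i 4 - Pi.single j 4 : Fin 24 → ℤ) k ^ 2 =
        (if k = i then 16 else 0) + (if k = j then 16 else 0) := by
      intro k
      simp only [Pi.sub_apply, Pi.single_apply]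
      split_ifs with h1 h2
      · exact absurd (h1.symm.trans h2) hij
      all_goals norm_num
    change ∑ k, (Pi.single i 4 - Pi.single j 4 : Fin 24 → ℤ) k ^ 2 = 32
    simp only [this, Finset.sum_add_distrib, Finset.sum_ite_eq', Finset.mem_univ, if_true]
    norm_num

theorem oddVectors_odd {x : Fin 24 → ℤ} (h : x ∈ oddVectors) : x 0 % 2 = 1 := by
  obtain ⟨⟨i, w⟩, -, rfl⟩ := Finset.mem_image.1 h
  simp only [signChange, oddVec]
  split_ifs <;> decide

theorem octadVectors_mod_four {x : Fin 24 → ℤ} (h : x ∈ octadVectors) :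
    (∀ k, x k % 2 = 0) ∧ ∃ k, x k % 4 = 2 := by
  obtain ⟨⟨w, A⟩, hp, rfl⟩ := Finset.mem_image.1 h
  simp only [signedOctads, Finset.mem_sigma, Finset.mem_filter] at hp
  refine ⟨fun k => by simp only [octadVec]; split_ifs <;> decide, ?_⟩
  have : (Finset.univ.filter fun i => w i = 1).Nonempty := by
    rw [← Finset.card_pos]
    exact (by rw [hp.1.2]; norm_num : 0 < weight w)
  obtain ⟨k, hk⟩ := this
  refine ⟨k, ?_⟩
  have hk : w k = 1 := by simpa using hk
  simp only [octadVec, hk, if_true]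
  split_ifs <;> decide

theorem pairVectors_mod_four {x : Fin 24 → ℤ} (h : x ∈ pairVectors) (k : Fin 24) :
    x k % 4 = 0 := by
  obtain ⟨⟨i, j⟩, -, rfl⟩ := Finset.mem_image.1 h
  simp only [Pi.sub_apply, Pi.single_apply]
  split_ifs <;> decide

/-- 24·4096 + 759·128 + 552 = 196008, where only the pairs (4, −4) of opposite sign are counted. The
bound suffices because 626² = 391876 < 2·196008 = 392016; without the pair vectors it would not. -/
theorem le_ncard_minimalVectors : 196008 ≤ minimalVectors.ncard := by
  choose c hc hcv using exists_eq_ofInt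
  have hc' : ∀ x hx, c (ofInt x hx) = x := fun x hx => (ofInt_injective (hcv (ofInt x hx))).symm
  have d1 : Disjoint oddVectors octadVectors := Finset.disjoint_left.2 fun x h h' => by
    have := oddVectors_odd h; have := (octadVectors_mod_four h').1 0; omega
  have d2 : Disjoint (oddVectors ∪ octadVectors) pairVectors := Finset.disjoint_left.2 fun x h h' => by
    rcases Finset.mem_union.1 h with h | h
    · have := oddVectors_odd h; have := pairVectors_mod_four h' 0; omega
    · obtain ⟨k, hk⟩ := (octadVectors_mod_four h).2
      have := pairVectors_mod_four h' k; omega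
  have hcard : ((oddVectors ∪ octadVectors) ∪ pairVectors).card = 196008 := by
    rw [Finset.card_union_of_disjoint d2, Finset.card_union_of_disjoint d1, card_oddVectors,
      card_octadVectors, card_pairVectors]
  rw [← hcard, ← Set.ncard_coe_finset]
  refine le_trans (Set.ncard_le_ncard ?_ (finite_minimalVectors.image c))
    (Set.ncard_image_le finite_minimalVectors)
  intro x hx
  have : IsLeechInt x ∧ ∑ i, x i ^ 2 = 32 := by
    rw [Finset.mem_coe, Finset.mem_union, Finset.mem_union] at hx
    rcases hx with (h | h) | h
    · exact minimal_of_mem_oddVectors h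
    · exact minimal_of_mem_octadVectors h
    · exact minimal_of_mem_pairVectors h
  exact ⟨ofInt x this.1, (ofInt_mem_minimalVectors this.1).2 this.2, hc' x this.1⟩

/-! ### Averaging overlaps over the group. -/

theorem translate_finite {S : Set leechLattice} (hS : S.Finite) (g : Co0) :
    (translate g S).Finite := hS.image _

theorem ncard_translate (g : Co0) (S : Set leechLattice) : (translate g S).ncard = S.ncard :=
  Set.ncard_image_of_injective S (g : leechLattice ≃ᵢ leechLattice).injective

theorem translate_subset_minimalVectors {S : Set leechLattice} (hS : S ⊆ minimalVectors)
    (g : Co0) : translate g S ⊆ minimalVectors := by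
  rintro _ ⟨v, hv, rfl⟩
  exact Co0_map_mem_minimalVectors g (hS hv)

open scoped Classical in
-- By transitivity, g ↦ b⁻¹ga⁻¹ matches the elements taking v' to w' with those taking v to w.
theorem sum_ite_apply_eq [Fintype Co0] {v w v' w' : leechLattice} (hv : v ∈ minimalVectors)
    (hw : w ∈ minimalVectors) (hv' : v' ∈ minimalVectors) (hw' : w' ∈ minimalVectors) :
    (∑ g : Co0, if (g : leechLattice ≃ᵢ leechLattice) v = w then 1 else 0) =
      ∑ g : Co0, if (g : leechLattice ≃ᵢ leechLattice) v' = w' then 1 else 0 := by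
  obtain ⟨a, rfl⟩ := exists_Co0_apply_eq hv' hv
  obtain ⟨b, rfl⟩ := exists_Co0_apply_eq hw hw'
  rw [← Equiv.sum_comp ((Equiv.mulRight a⁻¹).trans (Equiv.mulLeft b⁻¹))
    (fun g : Co0 => if (g : leechLattice ≃ᵢ leechLattice) _ = w then 1 else 0)]
  refine Finset.sum_congr rfl fun g _ => if_congr ?_ rfl rfl
  change (b : leechLattice ≃ᵢ leechLattice).symm ((g : leechLattice ≃ᵢ leechLattice)
    ((a : leechLattice ≃ᵢ leechLattice).symm ((a : leechLattice ≃ᵢ leechLattice) v'))) = w ↔ _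
  rw [IsometryEquiv.symm_apply_apply]
  exact IsometryEquiv.symm_apply_eq _

open scoped Classical in
-- Double counting of triples (g, x, y) with g x = y: each pair (x, y) is counted K times, K being
-- the order of the stabiliser of a minimal vector, and K|𝒞| = |`Co0`| by transitivity.
theorem sum_ncard_translate_inter [Fintype Co0] {S U : Set leechLattice}
    (hS : S ⊆ minimalVectors) (hU : U ⊆ minimalVectors) :
    (∑ g : Co0, (translate g S ∩ U).ncard) * minimalVectors.ncard =
      Fintype.card Co0 * (S.ncard * U.ncard) := by
  obtain ⟨s, rfl⟩ := (finite_minimalVectors.subset hS).exists_finset_coe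
  obtain ⟨u, rfl⟩ := (finite_minimalVectors.subset hU).exists_finset_coe
  obtain ⟨c, hc⟩ := finite_minimalVectors.exists_finset_coe
  obtain ⟨v, hv⟩ : minimalVectors.Nonempty := by
    refine Set.nonempty_of_ncard_ne_zero ?_
    have := le_ncard_minimalVectors; omega
  set K := ∑ g : Co0, if (g : leechLattice ≃ᵢ leechLattice) v = v then 1 else 0 with hK
  have ov : ∀ g : Co0, (translate g (s : Set leechLattice) ∩ u).ncard =
      ∑ x ∈ s, ∑ y ∈ u, if (g : leechLattice ≃ᵢ leechLattice) x = y then 1 else 0 := by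
    intro g
    have e : translate g (s : Set leechLattice) ∩ u =
        ((s.filter fun x => (g : leechLattice ≃ᵢ leechLattice) x ∈ u).image
          (g : leechLattice ≃ᵢ leechLattice) : Finset leechLattice) := by
      ext y
      simp only [translate, Set.mem_inter_iff, Set.mem_image, Finset.mem_coe, Finset.mem_image,
        Finset.mem_filter]
      constructor
      · rintro ⟨⟨x, hx, rfl⟩, hy⟩; exact ⟨x, ⟨hx, hy⟩, rfl⟩
      · rintro ⟨x, ⟨hx, hy⟩, rfl⟩; exact ⟨⟨x, hx, rfl⟩, hy⟩
    rw [e, Set.ncard_coe_finset,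
      Finset.card_image_of_injective _ (g : leechLattice ≃ᵢ leechLattice).injective,
      Finset.card_filter]
    exact Finset.sum_congr rfl fun x _ => by rw [Finset.sum_ite_eq]
  have h1 : ∑ g : Co0, (translate g (s : Set leechLattice) ∩ u).ncard = s.card * (u.card * K) := by
    simp only [ov]
    rw [Finset.sum_comm, Finset.sum_const_nat (m := u.card * K)]
    intro x hx
    rw [Finset.sum_comm, Finset.sum_const_nat (m := K)]
    exact fun y hy => sum_ite_apply_eq (hS hx) (hU hy) hv hv
  have h2 : c.card * K = Fintype.card Co0 := by
    rw [← Finset.sum_const_nat (s := c)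
      (f := fun y => ∑ g : Co0, if (g : leechLattice ≃ᵢ leechLattice) v = y then 1 else 0)
      (m := K), Finset.sum_comm, Finset.sum_congr rfl (g := fun _ => 1)]
    · simp
    · intro g _
      rw [Finset.sum_ite_eq, if_pos]
      rw [← Finset.mem_coe, hc]
      exact Co0_map_mem_minimalVectors g hv
    · intro y hy
      exact sum_ite_apply_eq hv (hc ▸ (Finset.mem_coe.2 hy)) hv hv
  rw [h1, ← h2, ← hc]
  simp only [Set.ncard_coe_finset]
  ring

theorem exists_overlap_lt {S U : Set leechLattice} (hS : S ⊆ minimalVectors)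
    (hU : U ⊆ minimalVectors) {r : ℕ} (h : S.ncard * U.ncard < r * minimalVectors.ncard) :
    ∃ g : Co0, (translate g S ∩ U).ncard < r := by
  have := Fintype.ofFinite Co0
  by_contra! hr
  have hsum := sum_ncard_translate_inter hS hU
  have h1 : Fintype.card Co0 * r ≤ ∑ g : Co0, (translate g S ∩ U).ncard := by
    rw [← smul_eq_mul, ← Finset.card_univ, ← Finset.sum_const]
    exact Finset.sum_le_sum fun g _ => hr g
  have h2 := Nat.mul_le_mul_right minimalVectors.ncard h1
  rw [hsum, mul_assoc] at h2
  exact absurd (Nat.le_of_mul_le_mul_left h2 Fintype.card_pos) (not_le.2 h)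

/-! ### Antipodal sets and parity. -/

theorem neg_ne_self_of_minimal {v : leechLattice} (hv : v ∈ minimalVectors) : -v ≠ v := by
  intro h
  apply hv.1
  refine Subtype.ext (PiLp.ext fun i => ?_)
  have hi : -(v : EuclideanSpace ℝ (Fin 24)) i = (v : EuclideanSpace ℝ (Fin 24)) i :=
    congrArg (fun v : leechLattice => (v : EuclideanSpace ℝ (Fin 24)) i) h
  change (v : EuclideanSpace ℝ (Fin 24)) i = 0
  linarith

theorem exists_antipodal_subset {W : Set leechLattice} (hW : W ⊆ minimalVectors)
    (hneg : ∀ v ∈ W, -v ∈ W) (r : ℕ) (hr : 2 * r ≤ W.ncard) :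
    ∃ V ⊆ W, (∀ v ∈ V, -v ∈ V) ∧ V.ncard = 2 * r := by
  induction r with
  | zero => exact ⟨∅, Set.empty_subset _, by simp, by simp⟩
  | succ r ih =>
    obtain ⟨V, hVW, hV, hc⟩ := ih (by omega)
    have hVf : V.Finite := finite_minimalVectors.subset (hVW.trans hW)
    obtain ⟨v, hvW, hvV⟩ := Set.exists_mem_notMem_of_ncard_lt_ncard (s := V) (t := W) (by omega) hVf
    have hnV : -v ∉ V := fun h => hvV (by simpa using hV _ h)
    refine ⟨insert (-v) (insert v V), ?_, ?_, ?_⟩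
    · exact Set.insert_subset (hneg v hvW) (Set.insert_subset hvW hVW)
    · rintro x (rfl | rfl | hx)
      · simp
      · simp
      · exact Set.mem_insert_of_mem _ (Set.mem_insert_of_mem _ (hV x hx))
    · rw [Set.ncard_insert_of_notMem _ (hVf.insert v), Set.ncard_insert_of_notMem hvV hVf, hc]
      · ring
      · rintro (h | h)
        · exact neg_ne_self_of_minimal (hW hvW) h
        · exact hnV h

/-- If the size were odd, an antipodal subset missing a single v would exist; but −v ≠ v would be
missing as well. -/
theorem even_ncard_of_antipodal {W : Set leechLattice} (hW : W ⊆ minimalVectors)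
    (hneg : ∀ v ∈ W, -v ∈ W) : Even W.ncard := by
  by_contra hodd
  obtain ⟨r, hr⟩ := Nat.not_even_iff_odd.1 hodd
  obtain ⟨V, hVW, hV, hc⟩ := exists_antipodal_subset hW hneg r (by omega)
  have hWf := finite_minimalVectors.subset hW
  have h1 : (W \ V).ncard = 1 := by
    have := Set.ncard_sdiff_add_ncard_of_subset hVW hWf
    omega
  obtain ⟨v, hv⟩ := Set.ncard_eq_one.1 h1
  have hvm : v ∈ W \ V := by rw [hv]; rfl
  have : -v ∈ W \ V := ⟨hneg v hvm.1, fun h => hvm.2 (by simpa using hV _ h)⟩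
  rw [hv] at this
  exact neg_ne_self_of_minimal (hW hvm.1) this

theorem translate_antipodal {S : Set leechLattice} (hS : ∀ v ∈ S, -v ∈ S) (g : Co0) :
    ∀ v ∈ translate g S, -v ∈ translate g S := by
  rintro _ ⟨v, hv, rfl⟩
  exact ⟨-v, hS v hv, Co0_map_neg g v⟩

theorem IsAdmissible.of_subset_translate {S A : Set leechLattice} (hS : IsAdmissible S) {g : Co0}
    (hA : A ⊆ translate g S) (hneg : ∀ v ∈ A, -v ∈ A) : IsAdmissible A where
  minimal := hA.trans (translate_subset_minimalVectors hS.minimal g)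
  antipodal := hneg
  inner_le := by
    intro x hx y hy hxy
    obtain ⟨v, hv, rfl⟩ := hA hx
    obtain ⟨w, hw, rfl⟩ := hA hy
    rw [Co0_inner_map]
    exact hS.inner_le v hv w hw fun h => hxy (by rw [h])

theorem ncard_translate_diff {S : Set leechLattice} (hS : S ⊆ minimalVectors) (g : Co0)
    (U : Set leechLattice) :
    (translate g S \ U).ncard + (translate g S ∩ U).ncard = S.ncard := by
  rw [add_comm, Set.ncard_inter_add_ncard_sdiff_eq_ncard _ _
    (translate_finite (finite_minimalVectors.subset hS) g), ncard_translate]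

/-! ### Choice of two further sets. -/

/-- If the overlap of `g S` with `U` takes its least value `m` for more than half of all `g`, then
two such translates can be chosen with no common point. -/
theorem exists_disjoint_translates {S U : Set leechLattice} (hS : IsAdmissible S)
    (hcard : S.ncard ≤ 626) (hU : U ⊆ minimalVectors) (hUneg : ∀ v ∈ U, -v ∈ U) {m : ℕ}
    (hm : Even m) (hlt : S.ncard * U.ncard < (m + 1) * minimalVectors.ncard)
    (hall : ∀ g : Co0, m ≤ (translate g S ∩ U).ncard) :
    ∃ g g' : Co0, (translate g S ∩ U).ncard = m ∧ (translate g' S ∩ U).ncard = m ∧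
      Disjoint (translate g S) (translate g' S) := by
  classical
  have := Fintype.ofFinite Co0
  have hM := le_ncard_minimalVectors
  have heven : ∀ (g : Co0) (V : Set leechLattice), (∀ v ∈ V, -v ∈ V) →
      Even (translate g S ∩ V).ncard := fun g V hV =>
    even_ncard_of_antipodal
      (Set.inter_subset_left.trans (translate_subset_minimalVectors hS.minimal g))
      fun v hv => ⟨translate_antipodal hS.antipodal g v hv.1, hV v hv.2⟩
  -- The bound 626 enters here: the average overlap of hS with S is below 2, and an even overlap
  -- below 2 is zero.
  obtain ⟨h, hh⟩ : ∃ h : Co0, (translate h S ∩ S).ncard < 2 :=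
    exists_overlap_lt hS.minimal hS.minimal (by nlinarith)
  have hh0 : translate h S ∩ S = ∅ := by
    obtain ⟨r, hr⟩ := heven h S hS.antipodal
    refine (Set.ncard_eq_zero ?_).1 (by omega)
    exact (finite_minimalVectors.subset hS.minimal).inter_of_right _
  set A := Finset.univ.filter fun g : Co0 => (translate g S ∩ U).ncard = m with hA
  have hsum := sum_ncard_translate_inter hS.minimal hU
  -- By parity, every g outside A has overlap at least m + 2.
  have hlow : Fintype.card Co0 * (m + 2) ≤
      ∑ g : Co0, (translate g S ∩ U).ncard + 2 * A.card := by
    rw [hA, Finset.card_filter, Finset.mul_sum, ← Finset.sum_add_distrib, ← smul_eq_mul,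
      ← Finset.card_univ, ← Finset.sum_const]
    refine Finset.sum_le_sum fun g _ => ?_
    have h1 := hall g
    obtain ⟨r, hr⟩ := heven g U hUneg
    obtain ⟨q, hq⟩ := hm
    split_ifs <;> omega
  have hup : ∑ g : Co0, (translate g S ∩ U).ncard < Fintype.card Co0 * (m + 1) := by
    refine Nat.lt_of_mul_lt_mul_right (a := minimalVectors.ncard) ?_
    rw [hsum, mul_assoc]
    exact Nat.mul_lt_mul_of_pos_left hlt Fintype.card_pos
  have hhalf : Fintype.card Co0 < 2 * A.card := by
    have : Fintype.card Co0 * (m + 2) = Fintype.card Co0 * (m + 1) + Fintype.card Co0 := by ring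
    omega
  -- A and its right translate by h⁻¹ each contain more than half of the group, so they meet.
  obtain ⟨g, hgA, hgh⟩ : ∃ g ∈ A, g * h ∈ A := by
    by_contra! hno
    have hd : Disjoint A (A.image (· * h⁻¹)) := by
      refine Finset.disjoint_left.2 fun g hg hg' => ?_
      obtain ⟨a, ha, rfl⟩ := Finset.mem_image.1 hg'
      exact hno _ hg (by simpa using ha)
    have := Finset.card_le_univ (A ∪ A.image (· * h⁻¹))
    rw [Finset.card_union_of_disjoint hd,
      Finset.card_image_of_injective _ (mul_left_injective h⁻¹)] at this
    omega
  refine ⟨g, g * h, (Finset.mem_filter.1 hgA).2, (Finset.mem_filter.1 hgh).2, ?_⟩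
  refine Set.disjoint_left.2 ?_
  rintro _ ⟨v, hv, rfl⟩ ⟨w, hw, e⟩
  have e' : (h : leechLattice ≃ᵢ leechLattice) w = v :=
    (g : leechLattice ≃ᵢ leechLattice).injective e
  have : v ∈ translate h S ∩ S := ⟨⟨w, hw, e'⟩, hv⟩
  rw [hh0] at this
  exact this

theorem exists_two_further_sets {S U : Set leechLattice} (hS : IsAdmissible S)
    (hcard : S.ncard ≤ 626) (hU : U ⊆ minimalVectors) (hUneg : ∀ v ∈ U, -v ∈ U) {m : ℕ}
    (hm : Even m) (hle : m * minimalVectors.ncard ≤ S.ncard * U.ncard)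
    (hlt : S.ncard * U.ncard < (m + 1) * minimalVectors.ncard) :
    ∃ A B : Set leechLattice, ((∃ g, A ⊆ translate g S) ∧ ∀ v ∈ A, -v ∈ A) ∧
      ((∃ g, B ⊆ translate g S) ∧ ∀ v ∈ B, -v ∈ B) ∧
      Disjoint A U ∧ Disjoint B U ∧ Disjoint A B ∧
      ((A.ncard + m = S.ncard ∧ B.ncard + m = S.ncard) ∨
        (A.ncard + m = S.ncard + 2 ∧ B.ncard + m + 2 = S.ncard)) := by
  have hM := le_ncard_minimalVectors
  have diff_neg : ∀ (g : Co0) (V : Set leechLattice), (∀ v ∈ V, -v ∈ V) →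
      ∀ v ∈ translate g S \ V, -v ∈ translate g S \ V := fun g V hV v hv =>
    ⟨translate_antipodal hS.antipodal g v hv.1, fun h => hv.2 (by simpa using hV _ h)⟩
  have diff_sub : ∀ (g : Co0) (V : Set leechLattice), translate g S \ V ⊆ minimalVectors :=
    fun g V => Set.sdiff_subset.trans (translate_subset_minimalVectors hS.minimal g)
  have inter_even : ∀ (g : Co0) (V : Set leechLattice), (∀ v ∈ V, -v ∈ V) →
      Even (translate g S ∩ V).ncard := fun g V hV =>
    even_ncard_of_antipodal
      (Set.inter_subset_left.trans (translate_subset_minimalVectors hS.minimal g))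
      fun v hv => ⟨translate_antipodal hS.antipodal g v hv.1, hV v hv.2⟩
  by_cases hall : ∀ g : Co0, m ≤ (translate g S ∩ U).ncard
  · obtain ⟨g, g', hg, hg', hd⟩ :=
      exists_disjoint_translates hS hcard hU hUneg hm hlt hall
    refine ⟨translate g S \ U, translate g' S \ U, ⟨⟨g, Set.sdiff_subset⟩, diff_neg g U hUneg⟩,
      ⟨⟨g', Set.sdiff_subset⟩, diff_neg g' U hUneg⟩, Set.disjoint_sdiff_left,
      Set.disjoint_sdiff_left, hd.mono Set.sdiff_subset Set.sdiff_subset, Or.inl ⟨?_, ?_⟩⟩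
    · have := ncard_translate_diff hS.minimal g U; omega
    · have := ncard_translate_diff hS.minimal g' U; omega
  · push Not at hall
    obtain ⟨g, hg⟩ := hall
    obtain ⟨q, hq⟩ := hm
    obtain ⟨r, hr⟩ := inter_even g U hUneg
    obtain ⟨p, hp⟩ := even_ncard_of_antipodal hS.minimal hS.antipodal
    have hdiff := ncard_translate_diff hS.minimal g U
    have hUM : U.ncard ≤ minimalVectors.ncard := Set.ncard_le_ncard hU finite_minimalVectors
    -- If m ≥ |S|, the average forces U to be all of 𝒞; then every overlap is |S| = m, contrary to
    -- the choice of g. With parity this gives m + 2 ≤ |S|, so the size |S| − m − 2 of B does not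
    -- truncate.
    have hmn : m < S.ncard := by
      by_contra! hge
      have h1 : S.ncard * minimalVectors.ncard ≤ S.ncard * U.ncard :=
        (Nat.mul_le_mul_right _ hge).trans hle
      have hSpos : 0 < S.ncard := by
        by_contra! h0
        have : S.ncard = 0 := by omega
        rw [this, zero_mul] at hle
        have : 0 < m * minimalVectors.ncard := Nat.mul_pos (by omega) (by omega)
        omega
      have h2 := Nat.le_of_mul_le_mul_left h1 hSpos
      have h3 : U = minimalVectors := Set.eq_of_subset_of_ncard_le hU h2 finite_minimalVectors
      have h4 : translate g S \ U = ∅ := by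
        rw [h3, Set.sdiff_eq_empty]
        exact translate_subset_minimalVectors hS.minimal g
      have h5 : m ≤ S.ncard := by
        refine Nat.le_of_mul_le_mul_right (hle.trans (Nat.mul_le_mul_left _ hUM)) (by omega)
      rw [h4, Set.ncard_empty] at hdiff
      omega
    -- With |S| = 2p and m = 2q this is size |S| − m + 2, available because the even overlap is at
    -- most m − 2. The size is fixed exactly so that |A| + |B| comes out as 2(|S| − m).
    obtain ⟨A, hA, hAneg, hAc⟩ := exists_antipodal_subset (diff_sub g U) (diff_neg g U hUneg)
      (p + 1 - q) (by omega)
    have hAU : Disjoint A U := Set.disjoint_sdiff_left.mono_left hA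
    have hAm := hA.trans (diff_sub g U)
    have hU'neg : ∀ v ∈ U ∪ A, -v ∈ U ∪ A := by
      rintro v (h | h)
      · exact Or.inl (hUneg v h)
      · exact Or.inr (hAneg v h)
    have hU'c : (U ∪ A).ncard = U.ncard + A.ncard :=
      Set.ncard_union_eq hAU.symm (finite_minimalVectors.subset hU)
        (finite_minimalVectors.subset hAm)
    -- Here |A| ≤ |S| because m ≥ 2, so adding A raises the average by at most 626²/|𝒞| < 2. It
    -- stays below m + 3, and an even overlap below the odd number m + 3 is at most m + 2.
    obtain ⟨g', hg'⟩ := exists_overlap_lt (r := m + 3) hS.minimal (Set.union_subset hU hAm) (by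
      rw [hU'c]
      have h1 : A.ncard ≤ S.ncard := by omega
      have h2 : S.ncard * A.ncard ≤ 626 * 626 := Nat.mul_le_mul hcard (h1.trans hcard)
      nlinarith)
    obtain ⟨r', hr'⟩ := inter_even g' _ hU'neg
    have hdiff' := ncard_translate_diff hS.minimal g' (U ∪ A)
    obtain ⟨B, hB, hBneg, hBc⟩ := exists_antipodal_subset (diff_sub g' _) (diff_neg g' _ hU'neg)
      (p - q - 1) (by omega)
    have hBU : Disjoint B (U ∪ A) := Set.disjoint_sdiff_left.mono_left hB
    rw [Set.disjoint_union_right] at hBU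
    exact ⟨A, B, ⟨⟨g, hA.trans Set.sdiff_subset⟩, hAneg⟩, ⟨⟨g', hB.trans Set.sdiff_subset⟩, hBneg⟩,
      hAU, hBU.1, hBU.2.symm, Or.inr ⟨by omega, by omega⟩⟩

/-! ### Disjoint systems and their expected overlap. -/

theorem ncard_biUnion_Icc {T : ℕ → Set leechLattice} {k : ℕ}
    (hfin : ∀ j ∈ Finset.Icc 1 k, (T j).Finite)
    (hd : ∀ i ∈ Finset.Icc 1 k, ∀ j ∈ Finset.Icc 1 k, i ≠ j → Disjoint (T i) (T j)) :
    (⋃ j ∈ Finset.Icc 1 k, T j).ncard = ∑ j ∈ Finset.Icc 1 k, (T j).ncard := by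
  induction k with
  | zero => simp
  | succ k ih =>
    have hsub : ∀ j ∈ Finset.Icc 1 k, j ∈ Finset.Icc 1 (k + 1) := fun j hj => by
      rw [Finset.mem_Icc] at *; omega
    have hk : k + 1 ∈ Finset.Icc 1 (k + 1) := by rw [Finset.mem_Icc]; omega
    rw [Finset.sum_Icc_succ_top (by omega), ← ih (fun j hj => hfin j (hsub j hj))
      fun i hi j hj => hd i (hsub i hi) j (hsub j hj), ← Finset.insert_Icc_right_eq_Icc_add_one (by omega),
      Finset.set_biUnion_insert, Set.union_comm]
    refine Set.ncard_union_eq ?_ ?_ (hfin _ hk)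
    · refine Set.disjoint_iUnion₂_left.2 fun j hj => hd j (hsub j hj) _ hk ?_
      rw [Finset.mem_Icc] at hj; omega
    · exact (Finset.Icc 1 k).finite_toSet.biUnion fun j hj => hfin j (hsub j hj)

theorem IsDisjointSystem.biUnion_subset {S : Set leechLattice} {T : ℕ → Set leechLattice} {k : ℕ}
    (hT : IsDisjointSystem S T k) : (⋃ j ∈ Finset.Icc 1 k, T j) ⊆ minimalVectors :=
  Set.iUnion₂_subset fun j hj => (hT.admissible j hj).minimal

theorem IsDisjointSystem.ncard_biUnion {S : Set leechLattice} {T : ℕ → Set leechLattice} {k : ℕ}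
    (hT : IsDisjointSystem S T k) :
    (⋃ j ∈ Finset.Icc 1 k, T j).ncard = ∑ j ∈ Finset.Icc 1 k, (T j).ncard :=
  ncard_biUnion_Icc (fun j hj => finite_minimalVectors.subset (hT.admissible j hj).minimal)
    hT.disjoint

theorem IsDisjointSystem.expectedOverlap_eq {S : Set leechLattice} {T : ℕ → Set leechLattice}
    {k : ℕ} (hT : IsDisjointSystem S T k) (hS : S ⊆ minimalVectors) :
    expectedOverlap S T k =
      (S.ncard : ℝ) * (∑ j ∈ Finset.Icc 1 k, ((T j).ncard : ℝ)) / minimalVectors.ncard := by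
  have := Fintype.ofFinite Co0
  have hsum := sum_ncard_translate_inter hS hT.biUnion_subset
  rw [hT.ncard_biUnion] at hsum
  have hM : (minimalVectors.ncard : ℝ) ≠ 0 := by
    have := le_ncard_minimalVectors
    exact_mod_cast (by omega : minimalVectors.ncard ≠ 0)
  have hG : (Fintype.card Co0 : ℝ) ≠ 0 := by exact_mod_cast Fintype.card_ne_zero
  rw [expectedOverlap, finsum_eq_sum_of_fintype, Nat.card_eq_fintype_card, div_eq_div_iff hG hM]
  have h := congrArg (Nat.cast : ℕ → ℝ) hsum
  push_cast at h
  rw [h]; ring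

/-- With ⌊E_k⌋ even, the even floor loses less than 1 instead of less than 2; the strict bound
n|U|/|𝒞| < m + 1 in the main argument comes from this. -/
theorem evenFloor_of_even_floor {x : ℝ} (h : Even ⌊x⌋) : evenFloor x = ⌊x⌋ := by
  obtain ⟨r, hr⟩ := h
  have h1 := Int.floor_le x
  have h2 := Int.lt_floor_add_one x
  rw [hr] at h1 h2
  push_cast at h1 h2
  have : ⌊x / 2⌋ = r := Int.floor_eq_iff.2 ⟨by linarith, by linarith⟩
  rw [evenFloor, this, hr]; ring

/-- Two further sets extend a disjoint system. -/
theorem IsDisjointSystem.extend {S A B : Set leechLattice} {T : ℕ → Set leechLattice} {k : ℕ}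
    (hT : IsDisjointSystem S T k) (hk : 1 ≤ k) (hS : IsAdmissible S)
    (hA : (∃ g, A ⊆ translate g S) ∧ ∀ v ∈ A, -v ∈ A)
    (hB : (∃ g, B ⊆ translate g S) ∧ ∀ v ∈ B, -v ∈ B)
    (hAU : Disjoint A (⋃ j ∈ Finset.Icc 1 k, T j)) (hBU : Disjoint B (⋃ j ∈ Finset.Icc 1 k, T j))
    (hAB : Disjoint A B) :
    IsDisjointSystem S (fun j => if j = k + 1 then A else if j = k + 2 then B else T j)
      (k + 2) := by
  have cases : ∀ j ∈ Finset.Icc 1 (k + 2), j = k + 1 ∨ j = k + 2 ∨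
      (j ∈ Finset.Icc 1 k ∧ j ≠ k + 1 ∧ j ≠ k + 2) := by
    intro j hj
    simp only [Finset.mem_Icc] at *
    omega
  have hk2 : k + 2 ≠ k + 1 := by omega
  rw [Set.disjoint_iUnion₂_right] at hAU hBU
  refine ⟨?_, ?_, ?_, ?_⟩
  · rw [if_neg (by omega), if_neg (by omega), hT.first]
  · intro j hj
    rcases cases j hj with rfl | rfl | ⟨hj, h1, h2⟩
    · obtain ⟨⟨g, hg⟩, hneg⟩ := hA
      simpa using hS.of_subset_translate hg hneg
    · obtain ⟨⟨g, hg⟩, hneg⟩ := hB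
      simpa using hS.of_subset_translate hg hneg
    · simpa [h1, h2] using hT.admissible j hj
  · intro j hj
    rcases cases j hj with rfl | rfl | ⟨hj, h1, h2⟩
    · simpa using hA.1
    · simpa using hB.1
    · simpa [h1, h2] using hT.subset_translate j hj
  · intro i hi j hj hij
    rcases cases i hi with rfl | rfl | ⟨hi, h1, h2⟩ <;>
      rcases cases j hj with rfl | rfl | ⟨hj, h3, h4⟩
    · exact absurd rfl hij
    · simpa using hAB
    · simpa [h3, h4] using hAU j hj
    · simpa using hAB.symm
    · exact absurd rfl hij
    · simpa [h3, h4] using hBU j hj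
    · simpa [h1, h2] using (hAU i hi).symm
    · simpa [h1, h2] using (hBU i hi).symm
    · simpa [h1, h2, h3, h4] using hT.disjoint i hi j hj hij

end Leech

theorem corollary4p13
    (S : Set Leech.leechLattice) (hS : Leech.IsAdmissible S) (hcard : S.ncard ≤ 626)
    (k : ℕ) (hk2 : 2 ≤ k) (hk50 : k ≤ 50)
    (T : ℕ → Set Leech.leechLattice) (hT : Leech.IsDisjointSystem S T k)
    (heven : Even ⌊Leech.expectedOverlap S T k⌋) :
    ∃ T' : ℕ → Set Leech.leechLattice,
      (∀ j ∈ Finset.Icc 1 k, T' j = T j) ∧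
      Leech.IsDisjointSystem S T' (k + 2) ∧
      Leech.expectedOverlap S T' (k + 2) =
        (S.ncard : ℝ) *
          ((∑ j ∈ Finset.Icc 1 k, ((T j).ncard : ℝ)) +
            2 * ((S.ncard : ℝ) - (Leech.evenFloor (Leech.expectedOverlap S T k) : ℝ))) /
          (Leech.minimalVectors.ncard : ℝ) ∧
      ((T' (k + 1)).ncard : ℤ) + ((T' (k + 2)).ncard : ℤ) ≥
        2 * ((S.ncard : ℤ) - Leech.evenFloor (Leech.expectedOverlap S T k)) ∧
      2 * ((T' (k + 1)).ncard : ℤ) + ((T' (k + 2)).ncard : ℤ) ≥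
        3 * ((S.ncard : ℤ) - Leech.evenFloor (Leech.expectedOverlap S T k)) ∧
      ((((T' (k + 1)).ncard : ℤ) ≥
            (S.ncard : ℤ) - Leech.evenFloor (Leech.expectedOverlap S T k) ∧
          ((T' (k + 2)).ncard : ℤ) ≥
            (S.ncard : ℤ) - Leech.evenFloor (Leech.expectedOverlap S T k)) ∨
        (((T' (k + 1)).ncard : ℤ) ≥
            (S.ncard : ℤ) - Leech.evenFloor (Leech.expectedOverlap S T k) + 2 ∧
          ((T' (k + 2)).ncard : ℤ) ≥
            (S.ncard : ℤ) - Leech.evenFloor (Leech.expectedOverlap S T k) - 2)) := by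
  have hE := hT.expectedOverlap_eq hS.minimal
  have hM : (0 : ℝ) < Leech.minimalVectors.ncard := by
    have := Leech.le_ncard_minimalVectors
    exact_mod_cast (by omega : 0 < Leech.minimalVectors.ncard)
  rw [Leech.evenFloor_of_even_floor heven]
  have h0 : 0 ≤ ⌊Leech.expectedOverlap S T k⌋ := by
    rw [Int.floor_nonneg, hE]; positivity
  obtain ⟨m, hm⟩ := Int.eq_ofNat_of_zero_le h0
  have hfl := Int.floor_le (Leech.expectedOverlap S T k)
  have hfu := Int.lt_floor_add_one (Leech.expectedOverlap S T k)
  rw [hm] at heven hfl hfu ⊢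
  rw [hE] at hfl hfu
  rw [le_div_iff₀ hM] at hfl
  rw [div_lt_iff₀ hM] at hfu
  obtain ⟨A, B, hA, hB, hAU, hBU, hAB, hAB'⟩ := Leech.exists_two_further_sets hS hcard
    hT.biUnion_subset
    (fun v hv => by
      obtain ⟨j, hj, hv⟩ := Set.mem_iUnion₂.1 hv
      exact Set.mem_iUnion₂.2 ⟨j, hj, (hT.admissible j hj).antipodal v hv⟩)
    (m := m) (by exact_mod_cast heven)
    (by rw [hT.ncard_biUnion]; exact_mod_cast hfl) (by rw [hT.ncard_biUnion]; exact_mod_cast hfu)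
  have hT' := hT.extend (by omega) hS hA hB hAU hBU hAB
  have hold : ∀ j ∈ Finset.Icc 1 k,
      (if j = k + 1 then A else if j = k + 2 then B else T j) = T j := fun j hj => by
    rw [Finset.mem_Icc] at hj
    rw [if_neg (by omega), if_neg (by omega)]
  -- Both alternatives give the same exact total, so E_{k+2} is the same in each.
  have hsumAB : (A.ncard : ℝ) + B.ncard = 2 * (S.ncard - m) := by
    have : A.ncard + B.ncard + 2 * m = 2 * S.ncard := by omega
    have : (A.ncard : ℝ) + B.ncard + 2 * m = 2 * S.ncard := by exact_mod_cast this
    linarith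
  refine ⟨_, hold, hT', ?_, ?_⟩
  · rw [hT'.expectedOverlap_eq hS.minimal, Finset.sum_Icc_succ_top (by omega),
      Finset.sum_Icc_succ_top (by omega), Finset.sum_congr rfl fun j hj => by rw [hold j hj]]
    rw [if_pos rfl, if_neg (by omega), if_pos rfl, add_assoc, hsumAB]
    push_cast; rfl
  · rw [if_pos rfl, if_neg (by omega), if_pos rfl]
    omega
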